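/- Theorem 2.2. Let $(M,g)$ be a smooth $4$-dimensional Lorentzian manifold of signature $(+,+,+,-)$ with Levi-Civita connection $\nabla$ and Ricci tensor $S(V,W)=\operatorname{tr}\,(U\mapsto R(U,V)W)$, $R(U,V)W=\nabla_U\nabla_VW-\nabla_V\nabla_UW-\nabla_{[U,V]}W$. Suppose that $(M,g)$ is a perfect fluid spacetime with velocity field $\rho$, that is, $\rho$ is a smooth vector field with $g(\rho,\rho)=-1$, $S$ is not identically zero, and $S=\alpha g+\beta A\otimes A$ for some smooth functions $\alpha,\beta$ on $M$, where $A(U)=g(U,\rho)$. Suppose that $\rho$ is concircular, that is, there is a smooth function $\mu$ on $M$ with $\nabla_U\rho=\mu U$ for all vector fields $U$. Then $(M,g)$ is (locally) a generalized Robertson–Walker spacetime whose fibre is Einstein: every point of $M$ has an open neighbourhood that is isometric to a warped product $-J\times_{f^2}N$, i.e. to $J\times N$ with the metric $-dt^2+f(t)^2h$, where $J\subseteq\mathbb R$ is a nonempty open interval, $f>0$ is a smooth function on $J$, and $(N,h)$ is a connected $3$-dimensional Riemannian manifold that is Einstein, i.e. $\mathrm{Ric}_h=\lambda h$ for a constant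 $\lambda\in\mathbb R$. -/

import Mathlib

open scoped Manifold ContDiff Topology

noncomputable section

section Metric

variable (E : Type*) [NormedAddCommGroup E] [NormedSpace ℝ E]
  (M : Type*) [TopologicalSpace M] [ChartedSpace E M] [IsManifold 𝓘(ℝ, E) ∞ M]

/-- A smooth pseudo-Riemannian metric on the smooth manifold `M` (modelled on the vector space `E`,
without boundary): a smooth field of nondegenerate symmetric bilinear forms on the tangent
spaces. -/
structure PseudoRiemannianMetric where
  /-- the bilinear form on each tangent space -/
  form (x : M) : TangentSpace 𝓘(ℝ, E) x →L[ℝ] TangentSpace 𝓘(ℝ, E) x →L[ℝ] ℝ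
  symm (x : M) (v w : TangentSpace 𝓘(ℝ, E) x) : form x v w = form x w v
  nondegenerate (x : M) (v : TangentSpace 𝓘(ℝ, E) x) : (∀ w, form x v w = 0) → v = 0
  contMDiff : ContMDiff 𝓘(ℝ, E) (𝓘(ℝ, E).prod 𝓘(ℝ, E →L[ℝ] E →L[ℝ] ℝ)) ∞
    (fun x ↦ Bundle.TotalSpace.mk' (E →L[ℝ] E →L[ℝ] ℝ)
      (E := fun x : M ↦ TangentSpace 𝓘(ℝ, E) x →L[ℝ] TangentSpace 𝓘(ℝ, E) x →L[ℝ] ℝ) x (form x))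

end Metric

namespace PseudoRiemannianMetric

variable {E : Type*} [NormedAddCommGroup E] [NormedSpace ℝ E]
  {M : Type*} [TopologicalSpace M] [ChartedSpace E M] [IsManifold 𝓘(ℝ, E) ∞ M]
  (g : PseudoRiemannianMetric E M)

/-- The metric is Riemannian: positive definite at each point. -/
def IsRiemannian : Prop :=
  ∀ (x : M) (v : TangentSpace 𝓘(ℝ, E) x), v ≠ 0 → 0 < g.form x v v

/-- The metric is Lorentzian, of signature `(+, …, +, -)`: at each point some vector is
timelike, and the metric is positive definite on its orthogonal complement. -/
def IsLorentzian : Prop :=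
  ∀ x : M, ∃ v : TangentSpace 𝓘(ℝ, E) x, g.form x v v < 0 ∧
    ∀ w, g.form x v w = 0 → w ≠ 0 → 0 < g.form x w w

theorem eq_of_form_eq (x : M) {v w : TangentSpace 𝓘(ℝ, E) x}
    (h : ∀ z, g.form x v z = g.form x w z) : v = w :=
  sub_eq_zero.1 (g.nondegenerate x _ fun z ↦ by simp [h z])

theorem mdifferentiableAt_form {X Y : Π x : M, TangentSpace 𝓘(ℝ, E) x} {x : M}
    (hX : MDiffAt (T% X) x) (hY : MDiffAt (T% Y) x) :
    MDiffAt (fun y ↦ g.form y (X y) (Y y)) x := by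
  have : MDifferentiableAt 𝓘(ℝ, E) (𝓘(ℝ, E).prod 𝓘(ℝ)) (fun m ↦ Bundle.TotalSpace.mk' ℝ
      (E := Bundle.Trivial M ℝ) m (g.form m (X m) (Y m))) x := by
    apply MDifferentiableAt.clm_bundle_apply₂ (F₁ := E) (F₂ := E)
    · exact g.contMDiff.contMDiffAt.mdifferentiableAt (by simp)
    · exact hX
    · exact hY
  simp only [mdifferentiableAt_totalSpace] at this
  exact this.2

theorem ext_endo (x : M) {A B : TangentSpace 𝓘(ℝ, E) x →L[ℝ] TangentSpace 𝓘(ℝ, E) x}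
    (h : ∀ X Z : Π x : M, TangentSpace 𝓘(ℝ, E) x, MDiffAt (T% X) x → MDiffAt (T% Z) x →
      g.form x (A (X x)) (Z x) = g.form x (B (X x)) (Z x)) : A = B := by
  ext1 v
  refine g.eq_of_form_eq x fun z ↦ ?_
  simpa using h (FiberBundle.extend E v) (FiberBundle.extend E z)
    (FiberBundle.mdifferentiableAt_extend ..) (FiberBundle.mdifferentiableAt_extend ..)

/-- The right-hand side of the Koszul formula, halved: the number that `g (∇_X Y) Z` has to be
at the point `x`. -/
def koszul (X Y Z : Π x : M, TangentSpace 𝓘(ℝ, E) x) (x : M) : ℝ :=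
  (1 / 2) * (mvfderiv 𝓘(ℝ, E) (fun y ↦ g.form y (Y y) (Z y)) x (X x)
    + mvfderiv 𝓘(ℝ, E) (fun y ↦ g.form y (Z y) (X y)) x (Y x)
    - mvfderiv 𝓘(ℝ, E) (fun y ↦ g.form y (X y) (Y y)) x (Z x)
    + g.form x (VectorField.mlieBracket 𝓘(ℝ, E) X Y x) (Z x)
    - g.form x (VectorField.mlieBracket 𝓘(ℝ, E) Y Z x) (X x)
    + g.form x (VectorField.mlieBracket 𝓘(ℝ, E) Z X x) (Y x))

variable [FiniteDimensional ℝ E]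

theorem tensorialAt_koszul_left {Y Z : Π x : M, TangentSpace 𝓘(ℝ, E) x} {x : M}
    (hY : MDiffAt (T% Y) x) (hZ : MDiffAt (T% Z) x) :
    TensorialAt 𝓘(ℝ, E) E (fun X ↦ g.koszul X Y Z x) x where
  smul {f X} hf hX := by
    have h1 : (fun y ↦ g.form y (Z y) ((f • X) y)) = f * fun y ↦ g.form y (Z y) (X y) := by
      ext y; simp
    have h2 : (fun y ↦ g.form y ((f • X) y) (Y y)) = f * fun y ↦ g.form y (X y) (Y y) := by
      ext y; simp
    have e := g.symm x (X x) (Z x)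
    simp only [koszul]
    rw [h1, h2, mvfderiv_mul hf (g.mdifferentiableAt_form hZ hX),
      mvfderiv_mul hf (g.mdifferentiableAt_form hX hY),
      VectorField.mlieBracket_smul_left hf hX, VectorField.mlieBracket_smul_right hf hX]
    simp [e]
    ring
  add {X X'} hX hX' := by
    have h1 : (fun y ↦ g.form y (Z y) ((X + X') y)) =
        (fun y ↦ g.form y (Z y) (X y)) + fun y ↦ g.form y (Z y) (X' y) := by
      ext y; simp
    have h2 : (fun y ↦ g.form y ((X + X') y) (Y y)) =
        (fun y ↦ g.form y (X y) (Y y)) + fun y ↦ g.form y (X' y) (Y y) := by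
      ext y; simp
    simp only [koszul]
    rw [h1, h2, mvfderiv_add (g.mdifferentiableAt_form hZ hX) (g.mdifferentiableAt_form hZ hX'),
      mvfderiv_add (g.mdifferentiableAt_form hX hY) (g.mdifferentiableAt_form hX' hY),
      VectorField.mlieBracket_add_left hX hX', VectorField.mlieBracket_add_right hX hX']
    simp
    ring

theorem tensorialAt_koszul_right {X Y : Π x : M, TangentSpace 𝓘(ℝ, E) x} {x : M}
    (hX : MDiffAt (T% X) x) (hY : MDiffAt (T% Y) x) :
    TensorialAt 𝓘(ℝ, E) E (fun Z ↦ g.koszul X Y Z x) x where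
  smul {f Z} hf hZ := by
    have h1 : (fun y ↦ g.form y (Y y) ((f • Z) y)) = f * fun y ↦ g.form y (Y y) (Z y) := by
      ext y; simp
    have h2 : (fun y ↦ g.form y ((f • Z) y) (X y)) = f * fun y ↦ g.form y (Z y) (X y) := by
      ext y; simp
    have e := g.symm x (Y x) (Z x)
    simp only [koszul]
    rw [h1, h2, mvfderiv_mul hf (g.mdifferentiableAt_form hY hZ),
      mvfderiv_mul hf (g.mdifferentiableAt_form hZ hX),
      VectorField.mlieBracket_smul_left hf hZ, VectorField.mlieBracket_smul_right hf hZ]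
    simp [e]
    ring
  add {Z Z'} hZ hZ' := by
    have h1 : (fun y ↦ g.form y (Y y) ((Z + Z') y)) =
        (fun y ↦ g.form y (Y y) (Z y)) + fun y ↦ g.form y (Y y) (Z' y) := by
      ext y; simp
    have h2 : (fun y ↦ g.form y ((Z + Z') y) (X y)) =
        (fun y ↦ g.form y (Z y) (X y)) + fun y ↦ g.form y (Z' y) (X y) := by
      ext y; simp
    simp only [koszul]
    rw [h1, h2, mvfderiv_add (g.mdifferentiableAt_form hY hZ) (g.mdifferentiableAt_form hY hZ'),
      mvfderiv_add (g.mdifferentiableAt_form hZ hX) (g.mdifferentiableAt_form hZ' hX),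
      VectorField.mlieBracket_add_left hZ hZ', VectorField.mlieBracket_add_right hZ hZ']
    simp
    ring

/-- The Koszul expression of a vector field `Y` differentiable at `x`, as a bilinear form in the
values of `X` and `Z` at `x`. -/
def koszulForm (Y : Π x : M, TangentSpace 𝓘(ℝ, E) x) (x : M) (hY : MDiffAt (T% Y) x) :
    TangentSpace 𝓘(ℝ, E) x →L[ℝ] TangentSpace 𝓘(ℝ, E) x →L[ℝ] ℝ :=
  TensorialAt.mkHom₂ (fun X Z ↦ g.koszul X Y Z x) x
    (fun _ hZ ↦ g.tensorialAt_koszul_left hY hZ) (fun _ hX ↦ g.tensorialAt_koszul_right hX hY)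

theorem koszulForm_apply {X Y Z : Π x : M, TangentSpace 𝓘(ℝ, E) x} {x : M}
    (hX : MDiffAt (T% X) x) (hY : MDiffAt (T% Y) x) (hZ : MDiffAt (T% Z) x) :
    g.koszulForm Y x hY (X x) (Z x) = g.koszul X Y Z x :=
  TensorialAt.mkHom₂_apply (Φ := fun X Z ↦ g.koszul X Y Z x) _ _ hX hZ

/-- A nondegenerate metric lets one solve `g (A v) w = B v w` for the endomorphism `A`. -/
theorem exists_raise (x : M)
    (B : TangentSpace 𝓘(ℝ, E) x →L[ℝ] TangentSpace 𝓘(ℝ, E) x →L[ℝ] ℝ) :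
    ∃ A : TangentSpace 𝓘(ℝ, E) x →L[ℝ] TangentSpace 𝓘(ℝ, E) x,
      ∀ v w, g.form x (A v) w = B v w := by
  let G : E →L[ℝ] E →L[ℝ] ℝ := g.form x
  let B' : E →L[ℝ] E →L[ℝ] ℝ := B
  have hinj : Function.Injective (G : E →ₗ[ℝ] (E →L[ℝ] ℝ)) := by
    rw [injective_iff_map_eq_zero]
    intro v hv
    exact g.nondegenerate x v fun w ↦ congr($hv w)
  have hrank : Module.finrank ℝ E = Module.finrank ℝ (E →L[ℝ] ℝ) := by
    rw [← (LinearMap.toContinuousLinearMap (𝕜 := ℝ) (E := E) (F' := ℝ)).finrank_eq]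
    exact (Subspace.dual_finrank_eq (K := ℝ) (V := E)).symm
  let e := LinearEquiv.ofInjectiveOfFinrankEq (G : E →ₗ[ℝ] (E →L[ℝ] ℝ)) hinj hrank
  let A : E →L[ℝ] E :=
    LinearMap.toContinuousLinearMap (e.symm.toLinearMap ∘ₗ (B' : E →ₗ[ℝ] (E →L[ℝ] ℝ)))
  refine ⟨A, fun v w ↦ ?_⟩
  have : e (e.symm (B' v)) = B' v := e.apply_symm_apply _
  exact congr($this w)

open scoped Classical in
/-- The values of the Levi-Civita connection, determined by the Koszul formula:
`leviCivitaFun Y x v` is `∇_v Y` at `x` for `Y` differentiable at `x` (and `0` otherwise). -/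
def leviCivitaFun (Y : Π x : M, TangentSpace 𝓘(ℝ, E) x) (x : M) :
    TangentSpace 𝓘(ℝ, E) x →L[ℝ] TangentSpace 𝓘(ℝ, E) x :=
  if hY : MDiffAt (T% Y) x then (g.exists_raise x (g.koszulForm Y x hY)).choose else 0

theorem form_leviCivitaFun {X Y Z : Π x : M, TangentSpace 𝓘(ℝ, E) x} {x : M}
    (hX : MDiffAt (T% X) x) (hY : MDiffAt (T% Y) x) (hZ : MDiffAt (T% Z) x) :
    g.form x (g.leviCivitaFun Y x (X x)) (Z x) = g.koszul X Y Z x := by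
  rw [leviCivitaFun, dif_pos hY, (g.exists_raise x (g.koszulForm Y x hY)).choose_spec,
    g.koszulForm_apply hX hY hZ]

/-- The Levi-Civita connection of a pseudo-Riemannian metric. -/
def leviCivita :
    CovariantDerivative 𝓘(ℝ, E) E (fun x : M ↦ TangentSpace 𝓘(ℝ, E) x) where
  toFun := g.leviCivitaFun
  isCovariantDerivativeOnUniv :=
    { add := by
        intro Y Y' x hY hY' _
        refine g.ext_endo x fun X Z hX hZ ↦ ?_
        have h1 : (fun y ↦ g.form y ((Y + Y') y) (Z y)) =
            (fun y ↦ g.form y (Y y) (Z y)) + fun y ↦ g.form y (Y' y) (Z y) := by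
          ext y; simp
        have h2 : (fun y ↦ g.form y (X y) ((Y + Y') y)) =
            (fun y ↦ g.form y (X y) (Y y)) + fun y ↦ g.form y (X y) (Y' y) := by
          ext y; simp
        rw [g.form_leviCivitaFun hX (mdifferentiableAt_add_section hY hY') hZ]
        simp only [add_apply, map_add]
        rw [g.form_leviCivitaFun hX hY hZ, g.form_leviCivitaFun hX hY' hZ]
        simp only [koszul]
        rw [h1, h2,
          mvfderiv_add (g.mdifferentiableAt_form hY hZ) (g.mdifferentiableAt_form hY' hZ),
          mvfderiv_add (g.mdifferentiableAt_form hX hY) (g.mdifferentiableAt_form hX hY'),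
          VectorField.mlieBracket_add_left hY hY', VectorField.mlieBracket_add_right hY hY']
        simp
        ring
      leibniz := by
        intro Y f x hY hf _
        refine g.ext_endo x fun X Z hX hZ ↦ ?_
        have h1 : (fun y ↦ g.form y ((f • Y) y) (Z y)) = f * fun y ↦ g.form y (Y y) (Z y) := by
          ext y; simp
        have h2 : (fun y ↦ g.form y (X y) ((f • Y) y)) = f * fun y ↦ g.form y (X y) (Y y) := by
          ext y; simp
        have e := g.symm x (X x) (Y x)
        rw [g.form_leviCivitaFun hX (hf.smul_section hY) hZ]
        simp only [add_apply, map_add, smul_apply,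
          map_smul, ContinuousLinearMap.smulRight_apply]
        rw [g.form_leviCivitaFun hX hY hZ]
        simp only [koszul]
        rw [h1, h2, mvfderiv_mul hf (g.mdifferentiableAt_form hY hZ),
          mvfderiv_mul hf (g.mdifferentiableAt_form hX hY),
          VectorField.mlieBracket_smul_left hf hY, VectorField.mlieBracket_smul_right hf hY]
        simp [e]
        ring }

/-- The Levi-Civita connection is torsion-free. -/
theorem leviCivita_torsion {X Y : Π x : M, TangentSpace 𝓘(ℝ, E) x} {x : M}
    (hX : MDiffAt (T% X) x) (hY : MDiffAt (T% Y) x) :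
    g.leviCivita Y x (X x) - g.leviCivita X x (Y x) = VectorField.mlieBracket 𝓘(ℝ, E) X Y x := by
  refine g.eq_of_form_eq x fun z ↦ ?_
  have hZ : MDiffAt (T% (FiberBundle.extend E z)) x := FiberBundle.mdifferentiableAt_extend ..
  have h1 := g.form_leviCivitaFun hX hY hZ
  have h2 := g.form_leviCivitaFun hY hX hZ
  have c1 : (fun y ↦ g.form y (X y) (Y y)) = fun y ↦ g.form y (Y y) (X y) := by
    ext y; exact g.symm ..
  have c2 : (fun y ↦ g.form y (X y) (FiberBundle.extend E z y)) =
      fun y ↦ g.form y (FiberBundle.extend E z y) (X y) := by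
    ext y; exact g.symm ..
  have c3 : (fun y ↦ g.form y (Y y) (FiberBundle.extend E z y)) =
      fun y ↦ g.form y (FiberBundle.extend E z y) (Y y) := by
    ext y; exact g.symm ..
  have b1 : VectorField.mlieBracket 𝓘(ℝ, E) Y X x = -VectorField.mlieBracket 𝓘(ℝ, E) X Y x :=
    VectorField.mlieBracket_swap_apply
  have b2 : VectorField.mlieBracket 𝓘(ℝ, E) Y (FiberBundle.extend E z) x =
      -VectorField.mlieBracket 𝓘(ℝ, E) (FiberBundle.extend E z) Y x :=
    VectorField.mlieBracket_swap_apply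
  have b3 : VectorField.mlieBracket 𝓘(ℝ, E) X (FiberBundle.extend E z) x =
      -VectorField.mlieBracket 𝓘(ℝ, E) (FiberBundle.extend E z) X x :=
    VectorField.mlieBracket_swap_apply
  simp only [koszul, c1, c2, c3, b1, b2, b3, FiberBundle.extend_apply_self, map_neg, neg_apply]
    at h1 h2
  change g.form x (g.leviCivitaFun Y x (X x) - g.leviCivitaFun X x (Y x)) z = _
  rw [map_sub, sub_apply, h1, h2]
  ring

/-- The Levi-Civita connection is compatible with the metric. -/
theorem leviCivita_metric {X Y Z : Π x : M, TangentSpace 𝓘(ℝ, E) x} {x : M}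
    (hX : MDiffAt (T% X) x) (hY : MDiffAt (T% Y) x) (hZ : MDiffAt (T% Z) x) :
    mvfderiv 𝓘(ℝ, E) (fun y ↦ g.form y (Y y) (Z y)) x (X x) =
      g.form x (g.leviCivita Y x (X x)) (Z x) + g.form x (Y x) (g.leviCivita Z x (X x)) := by
  have h1 := g.form_leviCivitaFun hX hY hZ
  have h2 := g.form_leviCivitaFun hX hZ hY
  have c1 : (fun y ↦ g.form y (X y) (Y y)) = fun y ↦ g.form y (Y y) (X y) := by
    ext y; exact g.symm ..
  have c2 : (fun y ↦ g.form y (X y) (Z y)) = fun y ↦ g.form y (Z y) (X y) := by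
    ext y; exact g.symm ..
  have c3 : (fun y ↦ g.form y (Z y) (Y y)) = fun y ↦ g.form y (Y y) (Z y) := by
    ext y; exact g.symm ..
  have b1 : VectorField.mlieBracket 𝓘(ℝ, E) Y X x = -VectorField.mlieBracket 𝓘(ℝ, E) X Y x :=
    VectorField.mlieBracket_swap_apply
  have b2 : VectorField.mlieBracket 𝓘(ℝ, E) Z Y x = -VectorField.mlieBracket 𝓘(ℝ, E) Y Z x :=
    VectorField.mlieBracket_swap_apply
  have b3 : VectorField.mlieBracket 𝓘(ℝ, E) X Z x = -VectorField.mlieBracket 𝓘(ℝ, E) Z X x :=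
    VectorField.mlieBracket_swap_apply
  simp only [koszul, c1, c2, c3, b1, b2, b3, map_neg, neg_apply] at h1 h2
  change _ = g.form x (g.leviCivitaFun Y x (X x)) (Z x) + g.form x (Y x) (g.leviCivitaFun Z x (X x))
  rw [g.symm x (Y x), h1, h2]
  ring

/-- The curvature operator `R(X, Y) Z = ∇_X ∇_Y Z - ∇_Y ∇_X Z - ∇_[X, Y] Z`. -/
def curvature (X Y Z : Π x : M, TangentSpace 𝓘(ℝ, E) x) (x : M) : TangentSpace 𝓘(ℝ, E) x :=
  g.leviCivita (fun y ↦ g.leviCivita Z y (Y y)) x (X x)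
    - g.leviCivita (fun y ↦ g.leviCivita Z y (X y)) x (Y x)
    - g.leviCivita Z x (VectorField.mlieBracket 𝓘(ℝ, E) X Y x)

/-- The Ricci tensor `S(v, w) = tr (u ↦ R(u, v) w)`. The curvature operator is tensorial, so it is
evaluated at tangent vectors by extending them to vector fields that are smooth near `x` (here,
with constant coefficients in a chart at `x`); the trace is taken in a basis of the tangent space,
which is a copy of the model space `E`. -/
def ricci (x : M) (v w : TangentSpace 𝓘(ℝ, E) x) : ℝ :=
  ∑ i, (Module.finBasis ℝ E).coord i
    (g.curvature (FiberBundle.extend (x := x) E (Module.finBasis ℝ E i : TangentSpace 𝓘(ℝ, E) x))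
      (FiberBundle.extend E v) (FiberBundle.extend E w) x)

/-- The metric is Einstein: the Ricci tensor is a constant multiple of the metric. -/
def IsEinstein : Prop :=
  ∃ c : ℝ, ∀ (x : M) (v w : TangentSpace 𝓘(ℝ, E) x), g.ricci x v w = c * g.form x v w

/-- The Lorentzian metric `g` is a perfect fluid spacetime with velocity field `ρ`: `ρ` is a smooth
unit timelike vector field, the Ricci tensor does not vanish identically, and
`S = α g + β A ⊗ A` for smooth functions `α`, `β`, where `A` is the 1-form `A(X) = g(X, ρ)`. -/
structure IsPerfectFluid (ρ : Π x : M, TangentSpace 𝓘(ℝ, E) x) : Prop where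
  lorentzian : g.IsLorentzian
  smooth : CMDiff ∞ (T% ρ)
  unit (x : M) : g.form x (ρ x) (ρ x) = -1
  ricci_ne_zero : ∃ (x : M) (v w : TangentSpace 𝓘(ℝ, E) x), g.ricci x v w ≠ 0
  ricci_eq : ∃ α β : M → ℝ, ContMDiff 𝓘(ℝ, E) 𝓘(ℝ) ∞ α ∧ ContMDiff 𝓘(ℝ, E) 𝓘(ℝ) ∞ β ∧
    ∀ (x : M) (v w : TangentSpace 𝓘(ℝ, E) x),
      g.ricci x v w = α x * g.form x v w + β x * (g.form x v (ρ x) * g.form x w (ρ x))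

/-- The vector field `ρ` is concircular: `∇_U ρ = μ U` for all `U`, with a smooth function `μ`. -/
def IsConcircular (ρ : Π x : M, TangentSpace 𝓘(ℝ, E) x) : Prop :=
  ∃ μ : M → ℝ, ContMDiff 𝓘(ℝ, E) 𝓘(ℝ) ∞ μ ∧
    ∀ (x : M) (u : TangentSpace 𝓘(ℝ, E) x), g.leviCivita ρ x u = μ x • u

/-- The open subset `U` of `M`, with the metric `g`, is a generalized Robertson-Walker spacetime
`-J ×_{f²} N` whose fibre `(N, h)` is an Einstein Riemannian manifold modelled on `F`: there is a
diffeomorphism `φ` from `J × N` onto `U`, with `J` an open interval and `N` connected, which pulls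
`g` back to the warped product metric `-dt² + f(t)² h`, with `f > 0` smooth on `J`. -/
def IsGRWWithEinsteinFibreOn (F : Type*) [NormedAddCommGroup F] [NormedSpace ℝ F]
    [FiniteDimensional ℝ F] (U : Set M) : Prop :=
  ∃ (N : Type) (_ : TopologicalSpace N) (_ : ChartedSpace F N) (_ : IsManifold 𝓘(ℝ, F) ∞ N)
    (_ : T2Space N) (_ : SecondCountableTopology N) (_ : ConnectedSpace N)
    (h : PseudoRiemannianMetric F N) (J : Set ℝ) (f : ℝ → ℝ) (φ : OpenPartialHomeomorph (ℝ × N) M),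
    h.IsRiemannian ∧ h.IsEinstein ∧
    IsOpen J ∧ J.OrdConnected ∧ J.Nonempty ∧ ContDiffOn ℝ ∞ f J ∧ (∀ t ∈ J, 0 < f t) ∧
    φ.source = J ×ˢ Set.univ ∧ φ.target = U ∧
    ContMDiffOn (𝓘(ℝ).prod 𝓘(ℝ, F)) 𝓘(ℝ, E) ∞ φ φ.source ∧
    ContMDiffOn 𝓘(ℝ, E) (𝓘(ℝ).prod 𝓘(ℝ, F)) ∞ φ.symm φ.target ∧
    ∀ t ∈ J, ∀ (q : N) (a b : ℝ) (u w : TangentSpace 𝓘(ℝ, F) q),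
      g.form (φ (t, q)) (mfderiv (𝓘(ℝ).prod 𝓘(ℝ, F)) 𝓘(ℝ, E) φ (t, q) (a, u))
        (mfderiv (𝓘(ℝ).prod 𝓘(ℝ, F)) 𝓘(ℝ, E) φ (t, q) (b, w)) =
      -(a * b) + f t ^ 2 * h.form q u w

end PseudoRiemannianMetric

end

/-!
A unit timelike concircular field is parallel: differentiating `g(ρ, ρ) = -1` along `ρ` itself, the
equation `∇_U ρ = μ U` gives `0 = 2 μ g(ρ, ρ) = -2 μ`
(`PseudoRiemannianMetric.IsConcircular.leviCivita_eq_zero`). Near each point the spacetime is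
therefore a product `-J × N`, that is, a warped product with `f = 1`. The dual 1-form of `ρ` is
closed and the flow of `ρ` consists of isometries, so that moving a hypersurface orthogonal to `ρ`
along this flow gives coordinates in which `g = -dt² + h` with `h` independent of `t`
(`exists_splitting_coordinates`, `metric_comp_of_parallel`). The fibre `N` is taken to be the whole
vector space `ℝ³`, onto which a small ball is stretched.

The Ricci tensor of a product with a line is the Ricci tensor of the fibre, so the perfect fluid
equation restricted to `ρ^⊥` reads `Ric_h = λ h` with `λ` a function on `N`. In dimension three the
Ricci tensor determines the curvature (`curvature_eq_of_trace_eq`), so `h` has pointwise constant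
curvature `λ / 2`, and the second Bianchi identity forces `λ` to be constant (Schur's lemma,
`IsChristoffel.fderiv_ricci_factor_eq_zero`).

All local computations are carried out on open subsets of vector spaces, for metrics given as fields
of bilinear forms (`IsMetricOn`) with their Christoffel symbols (`IsChristoffel`). They are
transferred to the manifold by the naturality of the Levi-Civita connection, its curvature and its
Ricci tensor in a parametrization (`IsParametrization.leviCivita_apply`,
`IsParametrization.curvature_apply`, `IsParametrization.ricci_apply`). The smooth dependence of
flows on the initial point is obtained from the inverse function theorem in a space of continuous
curves (`exists_contDiffOn_local_flow`).
-/

/-! ### Smooth dependence of flows on initial conditions -/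

section Flow

open Set Metric

universe u

/-- The inverse function theorem on a whole neighbourhood. For `n = ∞`, being `C^n` at a single
point does not imply being `C^n` near that point, so smoothness of the inverse is recorded on an
open set. -/
theorem exists_openPartialHomeomorph_contDiffOn_symm {X Y : Type*} [NormedAddCommGroup X]
    [NormedSpace ℝ X] [CompleteSpace X] [NormedAddCommGroup Y] [NormedSpace ℝ Y] [CompleteSpace Y]
    {f : X → Y} {U : Set X} (hU : IsOpen U) (hf : ContDiffOn ℝ ∞ f U) {a : X} (ha : a ∈ U)
    {f' : X ≃L[ℝ] Y} (hf' : HasFDerivAt f (f' : X →L[ℝ] Y) a) :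
    ∃ e : OpenPartialHomeomorph X Y, (e : X → Y) = f ∧ a ∈ e.source ∧ e.source ⊆ U ∧
      ContDiffOn ℝ ∞ e.symm e.target := by
  have hfa : ContDiffAt ℝ ∞ f a := hf.contDiffAt (hU.mem_nhds ha)
  let V : Set X := U ∩ fderiv ℝ f ⁻¹' range ((↑) : (X ≃L[ℝ] Y) → X →L[ℝ] Y)
  have hV : IsOpen V := (hf.continuousOn_fderiv_of_isOpen hU (by simp)).isOpen_inter_preimage hU
    ContinuousLinearEquiv.isOpen
  let e := (hfa.toOpenPartialHomeomorph f hf' (by simp)).restrOpen V hV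
  refine ⟨e, rfl, ⟨hfa.mem_toOpenPartialHomeomorph_source hf' (by simp), ha, f', hf'.fderiv.symm⟩,
    fun x hx ↦ hx.2.1, fun y hy ↦ ContDiffAt.contDiffWithinAt ?_⟩
  obtain ⟨hxU, g', hg'⟩ := (e.map_target hy).2
  have hx : ContDiffAt ℝ ∞ f (e.symm y) := hf.contDiffAt (hU.mem_nhds hxU)
  refine e.contDiffAt_symm (f₀' := g') hy ?_ hx
  rw [hg']
  exact (hx.differentiableAt (by simp)).hasFDerivAt

/-- Pointwise evaluation of a continuous family of operators at a continuous family of vectors. -/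
noncomputable def ContinuousMap.evalOperator (K : Type*) [TopologicalSpace K]
    [CompactSpace K] (E F : Type*) [NormedAddCommGroup E] [NormedSpace ℝ E]
    [NormedAddCommGroup F] [NormedSpace ℝ F] :
    C(K, E →L[ℝ] F) →L[ℝ] C(K, E) →L[ℝ] C(K, F) :=
  LinearMap.mkContinuous₂
    (LinearMap.mk₂ ℝ (fun (a : C(K, E →L[ℝ] F)) (b : C(K, E)) ↦
        (⟨fun s ↦ a s (b s), by fun_prop⟩ : C(K, F)))
      (fun _ _ _ ↦ by ext; simp) (fun _ _ _ ↦ by ext; simp)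
      (fun _ _ _ ↦ by ext; simp) (fun _ _ _ ↦ by ext; simp)) 1 fun a b ↦ by
    rw [one_mul, ContinuousMap.norm_le _ (by positivity)]
    intro s
    exact (ContinuousLinearMap.le_opNorm _ _).trans
      (mul_le_mul (a.norm_coe_le_norm s) (b.norm_coe_le_norm s) (norm_nonneg _) (norm_nonneg a))

/-- Composition with a `C^1` map is differentiable on spaces of continuous curves. -/
theorem ContinuousMap.hasFDerivAt_postcomp {K : Type*} [TopologicalSpace K] [CompactSpace K]
    {E F : Type*} [NormedAddCommGroup E] [NormedSpace ℝ E] [NormedAddCommGroup F]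
    [NormedSpace ℝ F] {v : E → F} {v' : E → E →L[ℝ] F} (hv : ∀ x, HasFDerivAt v (v' x) x)
    (hv' : Continuous v') (hc : Continuous v) (γ : C(K, E)) :
    HasFDerivAt (fun γ : C(K, E) ↦ (⟨v, hc⟩ : C(E, F)).comp γ)
      (ContinuousMap.evalOperator K E F ((⟨v', hv'⟩ : C(E, E →L[ℝ] F)).comp γ)) γ := by
  rw [hasFDerivAt_iff_isLittleO, Asymptotics.isLittleO_iff]
  intro c hc0
  obtain ⟨δ, hδ, hδc⟩ := (Metric.continuousAt_iff
    (f := fun γ : C(K, E) ↦ (⟨v', hv'⟩ : C(E, E →L[ℝ] F)).comp γ) (a := γ)).1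
      (ContinuousMap.continuous_postcomp _).continuousAt c hc0
  filter_upwards [ball_mem_nhds γ hδ] with η hη
  rw [ContinuousMap.norm_le _ (by positivity)]
  intro s
  have hs : ‖η s - γ s‖ ≤ ‖η - γ‖ := (η - γ).norm_coe_le_norm s
  have key : ∀ z ∈ ball (γ s) δ, ‖v' z - v' (γ s)‖ ≤ c := by
    intro z hz
    -- Compare `γ` with its translate by the constant vector `z - γ s`.
    have h1 : dist (γ + ContinuousMap.const K (z - γ s)) γ < δ := by
      rw [dist_eq_norm, add_sub_cancel_left]
      refine lt_of_le_of_lt ((ContinuousMap.norm_le _ (norm_nonneg _)).2 fun _ ↦ le_rfl)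
        (mem_ball_iff_norm.1 hz)
    have h2 : dist (v' (γ s + (z - γ s))) (v' (γ s)) ≤ c :=
      (ContinuousMap.dist_apply_le_dist s).trans (hδc h1).le
    rwa [dist_eq_norm, add_sub_cancel] at h2
  have hmem : η s ∈ ball (γ s) δ := by
    rw [mem_ball, dist_eq_norm]
    exact hs.trans_lt (by simpa [dist_eq_norm] using hη)
  have := (convex_ball (γ s) δ).norm_image_sub_le_of_norm_hasFDerivWithin_le'
    (fun x _ ↦ (hv x).hasFDerivWithinAt) key (mem_ball_self hδ) hmem
  exact this.trans (by gcongr)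

/-- Composition with a smooth map is smooth on spaces of continuous curves: its derivative is
again a composition, with `fderiv ℝ v`, followed by pointwise evaluation, so one inducts on the
order of differentiability. -/
theorem ContinuousMap.contDiff_postcomp {K : Type*} [TopologicalSpace K] [CompactSpace K]
    {E : Type u} [NormedAddCommGroup E] [NormedSpace ℝ E] {F : Type u} [NormedAddCommGroup F]
    [NormedSpace ℝ F] {v : E → F} (hv : ContDiff ℝ ∞ v) :
    ContDiff ℝ ∞ (fun γ : C(K, E) ↦ (⟨v, hv.continuous⟩ : C(E, F)).comp γ) := by
  refine contDiff_infty.2 fun n ↦ ?_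
  induction n generalizing F with
  | zero =>
    exact contDiff_zero.2 (ContinuousMap.continuous_postcomp _)
  | succ n ih =>
    have hv' : ContDiff ℝ ∞ (fderiv ℝ v) := hv.fderiv_right (by simp)
    refine contDiff_succ_iff_hasFDerivAt.2 ⟨_, ?_, fun γ ↦
      ContinuousMap.hasFDerivAt_postcomp
        (fun x ↦ (hv.differentiable (by simp) x).hasFDerivAt) hv'.continuous hv.continuous γ⟩
    exact (ContinuousMap.evalOperator K E F).contDiff.comp (ih hv')

theorem neg_one_le_one_real : (-1 : ℝ) ≤ 1 := by norm_num

theorem continuous_IccExtend_curve {E : Type*} [TopologicalSpace E] (γ : C(Icc (-1 : ℝ) 1, E)) :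
    Continuous (IccExtend neg_one_le_one_real γ) :=
  γ.continuous.Icc_extend'

variable {E : Type u} [NormedAddCommGroup E] [NormedSpace ℝ E]

/-- The primitive vanishing at `0` of a continuous curve on `[-1, 1]`. -/
noncomputable def primitiveCurve (E : Type u) [NormedAddCommGroup E] [NormedSpace ℝ E] :
    C(Icc (-1 : ℝ) 1, E) →L[ℝ] C(Icc (-1 : ℝ) 1, E) :=
  LinearMap.mkContinuous
    { toFun := fun γ ↦ ⟨fun s ↦ ∫ r in (0 : ℝ)..s, IccExtend neg_one_le_one_real γ r,
        (intervalIntegral.continuous_primitive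
          (fun _ _ ↦ (continuous_IccExtend_curve γ).intervalIntegrable _ _) 0).comp
            continuous_subtype_val⟩
      map_add' := fun γ η ↦ by
        ext s
        exact intervalIntegral.integral_add
          ((continuous_IccExtend_curve γ).intervalIntegrable _ _)
          ((continuous_IccExtend_curve η).intervalIntegrable _ _)
      map_smul' := fun c γ ↦ by
        ext s
        exact intervalIntegral.integral_smul c (IccExtend neg_one_le_one_real γ) } 1 fun γ ↦ by
    rw [ContinuousMap.norm_le _ (by positivity)]
    intro s
    refine (intervalIntegral.norm_integral_le_of_norm_le_const
      (C := ‖γ‖) fun r _ ↦ γ.norm_coe_le_norm (projIcc _ _ neg_one_le_one_real r)).trans ?_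
    have : |(s : ℝ)| ≤ 1 := abs_le.2 s.2
    rw [sub_zero, mul_comm]
    gcongr

theorem primitiveCurve_apply (γ : C(Icc (-1 : ℝ) 1, E)) (s : Icc (-1 : ℝ) 1) :
    primitiveCurve E γ s = ∫ r in (0 : ℝ)..s, IccExtend neg_one_le_one_real γ r := rfl

/-- The contraction by `c ∈ [-1, 1]` of the interval `[-1, 1]`. -/
def contractIcc (c : Icc (-1 : ℝ) 1) : C(Icc (-1 : ℝ) 1, Icc (-1 : ℝ) 1) where
  toFun s := ⟨c * s, by
    have h1 := abs_le.2 c.2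
    have h2 := abs_le.2 s.2
    rw [mem_Icc, ← abs_le, abs_mul]
    exact mul_le_one₀ h1 (abs_nonneg _) h2⟩
  continuous_toFun := by fun_prop

/-- Change of variables: this is what makes integral curves invariant under rescaling of time. -/
theorem smul_primitiveCurve_comp_contractIcc (γ : C(Icc (-1 : ℝ) 1, E)) (c s : Icc (-1 : ℝ) 1) :
    (c : ℝ) • primitiveCurve E (γ.comp (contractIcc c)) s =
      primitiveCurve E γ (contractIcc c s) := by
  have hI : ∀ r ∈ uIcc 0 (s : ℝ), r ∈ Icc (-1 : ℝ) 1 := fun r hr ↦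
    (uIcc_subset_Icc (by norm_num) s.2) hr
  rw [primitiveCurve_apply, primitiveCurve_apply]
  have : ∫ r in (0 : ℝ)..s, IccExtend neg_one_le_one_real (γ.comp (contractIcc c)) r =
      ∫ r in (0 : ℝ)..s, IccExtend neg_one_le_one_real γ (c * r) := by
    refine intervalIntegral.integral_congr fun r hr ↦ ?_
    exact (IccExtend_of_mem neg_one_le_one_real _ (hI r hr)).trans
      (IccExtend_of_mem neg_one_le_one_real γ (contractIcc c ⟨r, hI r hr⟩).2).symm
  rw [this, intervalIntegral.smul_integral_comp_mul_left, mul_zero]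
  rfl

/-- A smooth vector field has a smooth local flow. Integral curves are rescaled to the fixed time
interval `[-1, 1]`, where they are the zeros `γ` of the smooth map
`(x, τ, γ) ↦ γ - x - τ ∫ v ∘ γ`, to which the inverse function theorem applies at `τ = 0`. -/
theorem exists_contDiffOn_local_flow [CompleteSpace E] {v : E → E} (hv : ContDiff ℝ ∞ v) (x₀ : E) :
    ∃ ε > 0, ∃ Θ : ℝ × E → E, ContDiffOn ℝ ∞ Θ (ball 0 ε ×ˢ ball x₀ ε) ∧
      ∀ x ∈ ball x₀ ε, Θ (0, x) = x ∧
        ∀ t ∈ ball (0 : ℝ) ε, HasDerivAt (fun t ↦ Θ (t, x)) (v (Θ (t, x))) t := by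
  let C := C(Icc (-1 : ℝ) 1, E)
  let k : E →L[ℝ] C := LinearMap.mkContinuous
    { toFun := fun x ↦ ContinuousMap.const _ x
      map_add' := fun _ _ ↦ rfl
      map_smul' := fun _ _ ↦ rfl } 1 fun x ↦ by
    rw [ContinuousMap.norm_le _ (by positivity)]
    intro s
    rw [one_mul]
    exact le_rfl
  have hk (x : E) (s) : k x s = x := rfl
  let N : C → C := fun γ ↦ (⟨v, hv.continuous⟩ : C(E, E)).comp γ
  have hN : ContDiff ℝ ∞ N := ContinuousMap.contDiff_postcomp hv
  let W : C → C := fun γ ↦ primitiveCurve E (N γ)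
  have hW : ContDiff ℝ ∞ W := (primitiveCurve E).contDiff.comp hN
  let Φ : (E × ℝ) × C → (E × ℝ) × C := fun p ↦ (p.1, p.2 - k p.1.1 - p.1.2 • W p.2)
  have hΦ : ContDiff ℝ ∞ Φ := by
    have : ContDiff ℝ ∞ (fun p : (E × ℝ) × C ↦ W p.2) := hW.comp contDiff_snd
    fun_prop
  let a : (E × ℝ) × C := ((x₀, 0), k x₀)
  -- `L` is the derivative of `(x, τ) ↦ x + τ ∫ v ∘ γ`, and `A`, the derivative of `Φ` at `a`, is
  -- the corresponding shear.
  let L : E × ℝ →L[ℝ] C := k.comp (.fst ℝ E ℝ) +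
    (ContinuousLinearMap.snd ℝ E ℝ).smulRight (W (k x₀))
  let A : ((E × ℝ) × C) ≃L[ℝ] ((E × ℝ) × C) := ContinuousLinearEquiv.equivOfInverse
    ((ContinuousLinearMap.fst ℝ (E × ℝ) C).prod
      (ContinuousLinearMap.snd ℝ (E × ℝ) C - L.comp (.fst ℝ (E × ℝ) C)))
    ((ContinuousLinearMap.fst ℝ (E × ℝ) C).prod
      (ContinuousLinearMap.snd ℝ (E × ℝ) C + L.comp (.fst ℝ (E × ℝ) C)))
    (fun p ↦ by ext <;> simp) (fun p ↦ by ext <;> simp)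
  have hA : HasFDerivAt Φ (A : _ →L[ℝ] _) a := by
    have h1 : HasFDerivAt (fun p : (E × ℝ) × C ↦ p.1)
      (ContinuousLinearMap.fst ℝ (E × ℝ) C) a := hasFDerivAt_fst
    have h2 : HasFDerivAt (fun p : (E × ℝ) × C ↦ p.2)
      (ContinuousLinearMap.snd ℝ (E × ℝ) C) a := hasFDerivAt_snd
    have h3 := (hW.differentiable (by simp) a.2).hasFDerivAt.comp a h2
    have h4 := (k.hasFDerivAt (x := a.1.1)).comp a (hasFDerivAt_fst.comp a h1)
    have h5 := (hasFDerivAt_snd.comp a h1).smul h3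
    have h6 := h1.prodMk ((h2.sub h4).sub h5)
    refine h6.congr_fderiv ?_
    ext p <;> simp [A, L, a, sub_sub]
  obtain ⟨e, heΦ, hae, -, hsymm⟩ :=
    exists_openPartialHomeomorph_contDiffOn_symm isOpen_univ hΦ.contDiffOn (mem_univ a) hA
  have hΦa : Φ a = (a.1, 0) := by simp [Φ, a]
  have hta : (a.1, (0 : C)) ∈ e.target := by
    rw [← hΦa, ← heΦ]; exact e.map_source hae
  have hsa : e.symm (a.1, (0 : C)) = a := by
    rw [← hΦa, ← heΦ]; exact e.left_inv hae
  -- A box in the source of the local inverse.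
  obtain ⟨r, hr, hrsub⟩ := Metric.isOpen_iff.1 e.open_source a hae
  let ι : ℝ × E → (E × ℝ) × C := fun q ↦ ((q.2, q.1), 0)
  have hι : ContDiff ℝ ∞ ι := by fun_prop
  have hι0 : ι (0, x₀) = (a.1, 0) := rfl
  let γ : ℝ × E → C := fun q ↦ (e.symm (ι q)).2
  have hnhds : ∀ᶠ q in 𝓝 ((0 : ℝ), x₀), ι q ∈ e.target ∧ γ q ∈ ball (k x₀) r := by
    have h1 : ι (0, x₀) ∈ e.target := hta
    have h2 : ContinuousAt ι (0, x₀) := hι.continuous.continuousAt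
    refine (h2.eventually_mem (e.open_target.mem_nhds h1)).and ?_
    have h3 : ContinuousAt (fun q ↦ e.symm (ι q)) (0, x₀) :=
      ContinuousAt.comp (e.symm.continuousAt h1) h2
    have h4 : γ (0, x₀) = k x₀ := by simp only [γ]; rw [hι0, hsa]
    have h5 : ContinuousAt γ (0, x₀) := continuous_snd.continuousAt.comp h3
    exact h5.eventually_mem (isOpen_ball.mem_nhds (by rw [h4]; exact mem_ball_self hr))
  obtain ⟨δ, hδ, hδsub⟩ := Metric.eventually_nhds_iff_ball.1 hnhds
  let ε := min δ r / 2
  have hε : 0 < ε := by positivity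
  have hεδ : ε < δ := by have := min_le_left δ r; simp only [ε]; linarith
  have hεr : ε < r := by have := min_le_right δ r; simp only [ε]; linarith
  have hbox : ∀ t x, |t| ≤ ε → x ∈ ball x₀ ε →
      ι (t, x) ∈ e.target ∧ γ (t, x) ∈ ball (k x₀) r := fun t x ht hx ↦ hδsub _ (by
    rw [← ball_prod_same]
    exact ⟨by simpa using ht.trans_lt hεδ, ball_subset_ball hεδ.le hx⟩)
  have hsrc : ∀ t x (η : C), |t| ≤ ε → x ∈ ball x₀ ε → η ∈ ball (k x₀) r →
      ((x, t), η) ∈ e.source := fun t x η ht hx hη ↦ hrsub (by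
    rw [← ball_prod_same, ← ball_prod_same]
    exact ⟨⟨ball_subset_ball hεr.le hx, by simpa using ht.trans_lt hεr⟩, hη⟩)
  have hfst : ∀ q, ι q ∈ e.target → e.symm (ι q) = ((q.2, q.1), γ q) := by
    intro q hq
    have := e.right_inv hq
    rw [heΦ] at this
    exact Prod.ext (congrArg Prod.fst this :) rfl
  have heq : ∀ q, ι q ∈ e.target → γ q = k q.2 + q.1 • W (γ q) := by
    intro q hq
    have := e.right_inv hq
    rw [heΦ, hfst q hq] at this
    have h2 : γ q - k q.2 - q.1 • W (γ q) = 0 := congrArg Prod.snd this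
    rw [sub_sub] at h2
    exact sub_eq_zero.1 h2
  -- Uniqueness: a contracted integral curve is the integral curve of the contracted time.
  have hresc : ∀ t x (c : Icc (-1 : ℝ) 1), |t| ≤ ε → x ∈ ball x₀ ε →
      γ (c * t, x) = (γ (t, x)).comp (contractIcc c) := by
    intro t x c ht hx
    have hct : |c * t| ≤ ε := by
      rw [abs_mul]
      exact (mul_le_of_le_one_left (abs_nonneg _) (abs_le.2 c.2)).trans ht
    obtain ⟨h1, h2⟩ := hbox t x ht hx
    obtain ⟨h3, h4⟩ := hbox _ x hct hx
    have h5 : (γ (t, x)).comp (contractIcc c) ∈ ball (k x₀) r := by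
      rw [mem_ball, dist_eq_norm, ContinuousMap.norm_lt_iff _ hr] at h2 ⊢
      exact fun s ↦ h2 (contractIcc c s)
    have h6 : Φ ((x, c * t), (γ (t, x)).comp (contractIcc c)) = ι (c * t, x) := by
      refine Prod.ext rfl ?_
      ext s
      have h7 := congr($(heq (t, x) h1) (contractIcc c s))
      have h8 := smul_primitiveCurve_comp_contractIcc (N (γ (t, x))) c s
      have h9 : W ((γ (t, x)).comp (contractIcc c)) s =
        primitiveCurve E ((N (γ (t, x))).comp (contractIcc c)) s := rfl
      change γ (t, x) (contractIcc c s) = x + t • W (γ (t, x)) (contractIcc c s) at h7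
      change γ (t, x) (contractIcc c s) - x -
        ((c : ℝ) * t) • W ((γ (t, x)).comp (contractIcc c)) s = 0
      rw [h7, h9, mul_comm, mul_smul, h8]
      simp [W]
    rw [← heΦ] at h6
    have := e.left_inv (hsrc _ x _ hct hx h5)
    rw [h6, hfst _ h3] at this
    exact congrArg Prod.snd this
  -- The flow at time `t` is the end point of the curve rescaled by `t`. The contraction identity
  -- rewrites it as a point of a single curve, which solves the integral equation.
  let one : Icc (-1 : ℝ) 1 := ⟨1, by norm_num⟩
  have hΘ : ∀ x ∈ ball x₀ ε, ∀ c : Icc (-1 : ℝ) 1, γ (c * ε, x) one = γ (ε, x) c := by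
    intro x hx c
    rw [hresc ε x c (abs_of_pos hε).le hx]
    change γ (ε, x) _ = _
    congr 1
    exact Subtype.ext (mul_one _)
  refine ⟨ε, hε, fun q ↦ γ q one, ?_, fun x hx ↦ ⟨?_, fun t ht ↦ ?_⟩⟩
  · have h1 : ContDiffOn ℝ ∞ (fun q ↦ e.symm (ι q)) (ball 0 ε ×ˢ ball x₀ ε) :=
      hsymm.comp hι.contDiffOn fun q hq ↦
        (hbox q.1 q.2 (by simpa using (mem_ball.1 hq.1).le) hq.2).1
    exact (ContinuousMap.evalCLM ℝ one).contDiff.comp_contDiffOn (contDiff_snd.comp_contDiffOn h1)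
  · have h1 := congr($(heq (0, x) (hbox 0 x (by simpa using hε.le) hx).1) one)
    simpa [hk] using h1
  · have ht' : |t| < ε := by simpa using ht
    let z : Icc (-1 : ℝ) 1 → E := N (γ (ε, x))
    have hz : Continuous (IccExtend neg_one_le_one_real z) :=
      continuous_IccExtend_curve _
    have hmem : ∀ s : ℝ, |s| < ε → s / ε ∈ Icc (-1 : ℝ) 1 := fun s hs ↦ by
      rw [mem_Icc, ← abs_le, abs_div, abs_of_pos hε, div_le_one hε]
      exact hs.le
    have hγ : ∀ s (hs : |s| < ε), γ (s, x) one = γ (ε, x) ⟨s / ε, hmem s hs⟩ := by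
      intro s hs
      rw [← hΘ x hx, div_mul_cancel₀ _ hε.ne']
    have hint : ∀ s, |s| < ε → γ (s, x) one =
        x + ε • ∫ r in (0 : ℝ)..(s / ε), IccExtend neg_one_le_one_real z r := by
      intro s hs
      rw [hγ s hs]
      have h1 := congr($(heq (ε, x) (hbox ε x (abs_of_pos hε).le hx).1) ⟨s / ε, hmem s hs⟩)
      exact h1
    have hd : HasDerivAt (fun s : ℝ ↦
        x + ε • ∫ r in (0 : ℝ)..(s / ε), IccExtend neg_one_le_one_real z r)
        (v (γ (t, x) one)) t := by
      have h1 : HasDerivAt (fun s : ℝ ↦ s / ε) (1 / ε) t := (hasDerivAt_id t).div_const ε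
      have h2 := (intervalIntegral.integral_hasDerivAt_right (hz.intervalIntegrable 0 (t / ε))
        (hz.stronglyMeasurableAtFilter _ _) hz.continuousAt).scomp t h1
      have h3 := (h2.const_smul ε).const_add x
      refine h3.congr_deriv ?_
      rw [smul_smul, mul_one_div_cancel hε.ne', one_smul, IccExtend_of_mem _ _ (hmem t ht'),
        hγ t ht']
      rfl
    refine hd.congr_of_eventuallyEq ?_
    filter_upwards [isOpen_ball.mem_nhds ht] with s hs
    exact hint s (by simpa using hs)

end Flow

/-! ### Metrics on open subsets of a vector space -/

section Christoffel

open Set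

variable {V : Type*} [NormedAddCommGroup V] [NormedSpace ℝ V]

/-- A smooth field of nondegenerate symmetric bilinear forms on the open subset `S` of a vector
space. -/
structure IsMetricOn (G : V → V →L[ℝ] V →L[ℝ] ℝ) (S : Set V) : Prop where
  isOpen : IsOpen S
  contDiffOn : ContDiffOn ℝ ∞ G S
  symm : ∀ p ∈ S, ∀ u v, G p u v = G p v u
  nondegenerate : ∀ p ∈ S, ∀ v, (∀ w, G p v w = 0) → v = 0

/-- `Γ p u v` is the Levi-Civita derivative, at `p`, of the constant vector field `v` in the
direction `u`, for the metric `G` on the open set `S`: a smooth field that satisfies the Koszul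
formula for constant vector fields. -/
structure IsChristoffel (G : V → V →L[ℝ] V →L[ℝ] ℝ) (Γ : V → V →L[ℝ] V →L[ℝ] V) (S : Set V) :
    Prop where
  contDiffOn : ContDiffOn ℝ ∞ Γ S
  koszul : ∀ p ∈ S, ∀ u v w, 2 * G p (Γ p u v) w =
    fderiv ℝ G p u v w + fderiv ℝ G p v u w - fderiv ℝ G p w u v

theorem fderiv_clm_apply_const {X Y Z : Type*} [NormedAddCommGroup X] [NormedSpace ℝ X]
    [NormedAddCommGroup Y] [NormedSpace ℝ Y] [NormedAddCommGroup Z] [NormedSpace ℝ Z]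
    {A : X → Y →L[ℝ] Z} {p : X} (hA : DifferentiableAt ℝ A p) (k : X) (y : Y) :
    fderiv ℝ (fun q ↦ A q y) p k = fderiv ℝ A p k y := by
  rw [fderiv_clm_apply hA (differentiableAt_const y)]
  simp

theorem two_le_infty : (2 : WithTop ℕ∞) ≤ ∞ :=
  WithTop.coe_le_coe.2 (le_top : (2 : ℕ∞) ≤ ⊤)

/-- The endomorphism `u ↦ R(u, v) w`, where `R` is the curvature of the connection with Christoffel
symbols `Γ`. -/
noncomputable def curvatureMap (Γ : V → V →L[ℝ] V →L[ℝ] V) (p v w : V) : V →ₗ[ℝ] V where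
  toFun u := fderiv ℝ Γ p u v w - fderiv ℝ Γ p v u w + Γ p u (Γ p v w) - Γ p v (Γ p u w)
  map_add' _ _ := by simp; abel
  map_smul' _ _ := by simp [smul_sub, smul_add]

theorem curvatureMap_apply (Γ : V → V →L[ℝ] V →L[ℝ] V) (p u v w : V) :
    curvatureMap Γ p v w u =
      fderiv ℝ Γ p u v w - fderiv ℝ Γ p v u w + Γ p u (Γ p v w) - Γ p v (Γ p u w) := rfl

theorem curvatureMap_swap (Γ : V → V →L[ℝ] V →L[ℝ] V) (p u v w : V) :
    curvatureMap Γ p v w u = -curvatureMap Γ p u w v := by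
  simp only [curvatureMap_apply]
  abel

variable {G : V → V →L[ℝ] V →L[ℝ] ℝ} {Γ : V → V →L[ℝ] V →L[ℝ] V} {S : Set V}

namespace IsMetricOn

theorem differentiableAt (hG : IsMetricOn G S) {p : V} (hp : p ∈ S) : DifferentiableAt ℝ G p :=
  (hG.contDiffOn.contDiffAt (hG.isOpen.mem_nhds hp)).differentiableAt (by simp)

theorem fderiv_symm (hG : IsMetricOn G S) {p : V} (hp : p ∈ S) (u v w : V) :
    fderiv ℝ G p u v w = fderiv ℝ G p u w v := by
  have hd := hG.differentiableAt hp
  have h (v w : V) : fderiv ℝ (fun q ↦ G q v w) p u = fderiv ℝ G p u v w := by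
    rw [fderiv_clm_apply_const (hd.clm_apply (differentiableAt_const v)),
      fderiv_clm_apply_const hd]
  rw [← h, ← h]
  congr 1
  refine Filter.EventuallyEq.fderiv_eq ?_
  filter_upwards [hG.isOpen.mem_nhds hp] with q hq using hG.symm q hq v w

theorem eq_of_forall_apply_eq (hG : IsMetricOn G S) {p : V} (hp : p ∈ S) {v w : V}
    (h : ∀ z, G p v z = G p w z) : v = w :=
  sub_eq_zero.1 (hG.nondegenerate p hp _ fun z ↦ by simp [h z])

variable [FiniteDimensional ℝ V]

theorem isInvertible (hG : IsMetricOn G S) {p : V} (hp : p ∈ S) : (G p).IsInvertible := by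
  have hinj : Function.Injective (G p : V →ₗ[ℝ] (V →L[ℝ] ℝ)) := by
    rw [injective_iff_map_eq_zero]
    intro v hv
    exact hG.nondegenerate p hp v fun w ↦ congr($hv w)
  have hrank : Module.finrank ℝ V = Module.finrank ℝ (V →L[ℝ] ℝ) := by
    rw [← (LinearMap.toContinuousLinearMap (𝕜 := ℝ) (E := V) (F' := ℝ)).finrank_eq]
    exact (Subspace.dual_finrank_eq (K := ℝ) (V := V)).symm
  exact ⟨(LinearEquiv.ofInjectiveOfFinrankEq (G p : V →ₗ[ℝ] (V →L[ℝ] ℝ)) hinj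
    hrank).toContinuousLinearEquiv, by ext; rfl⟩

set_option maxSynthPendingDepth 4 in
/-- A metric has smooth Christoffel symbols. -/
theorem exists_isChristoffel (hG : IsMetricOn G S) : ∃ Γ, IsChristoffel G Γ S := by
  let D : V → V →L[ℝ] V →L[ℝ] V →L[ℝ] ℝ := fun p ↦ fderiv ℝ G p
  have hD : ContDiffOn ℝ ∞ D S := hG.contDiffOn.fderiv_of_isOpen hG.isOpen (m := ∞) (by simp)
  let K : V → V → V → V →L[ℝ] ℝ := fun p u v ↦
    (1 / 2 : ℝ) • (D p u v + D p v u - ((D p).flip u).flip v)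
  have hK (p u v w : V) : K p u v w = (1 / 2) * (D p u v w + D p v u w - D p w u v) := by
    simp [K]
  let Γ : V → V →L[ℝ] V →L[ℝ] V := fun p ↦
    LinearMap.toContinuousLinearMap (LinearMap.toContinuousLinearMap.toLinearMap ∘ₗ
      LinearMap.mk₂ ℝ (fun u v ↦ (G p).inverse (K p u v))
        (fun _ _ _ ↦ by rw [← map_add]; congr 1; ext; simp [hK]; ring)
        (fun _ _ _ ↦ by rw [← map_smul]; congr 1; ext; simp [hK]; ring)
        (fun _ _ _ ↦ by rw [← map_add]; congr 1; ext; simp [hK]; ring)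
        (fun _ _ _ ↦ by rw [← map_smul]; congr 1; ext; simp [hK]; ring))
  have hΓ (p u v : V) : Γ p u v = (G p).inverse (K p u v) := rfl
  refine ⟨Γ, ?_, fun p hp u v w ↦ ?_⟩
  · refine contDiffOn_clm_apply.2 fun u ↦ contDiffOn_clm_apply.2 fun v ↦ ?_
    simp only [hΓ]
    have hinv : ContDiffOn ℝ ∞ (fun p ↦ (G p).inverse) S := by
      intro p hp
      obtain ⟨e, he⟩ := hG.isInvertible hp
      have h1 : ContDiffAt ℝ ∞ ContinuousLinearMap.inverse (G p) := by
        rw [← he]; exact contDiffAt_map_inverse e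
      exact h1.comp_contDiffWithinAt p (hG.contDiffOn p hp)
    refine hinv.clm_apply (contDiffOn_clm_apply.2 fun w ↦ ?_)
    simp only [hK]
    have hDa (u v w : V) : ContDiffOn ℝ ∞ (fun p ↦ D p u v w) S :=
      ((hD.clm_apply contDiffOn_const).clm_apply contDiffOn_const).clm_apply contDiffOn_const
    exact contDiffOn_const.mul (((hDa u v w).add (hDa v u w)).sub (hDa w u v))
  · rw [hΓ, (hG.isInvertible hp).self_apply_inverse, hK]
    ring

end IsMetricOn

namespace IsChristoffel

theorem contDiffAt (hΓ : IsChristoffel G Γ S) (hG : IsMetricOn G S) {p : V} (hp : p ∈ S) :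
    ContDiffAt ℝ ∞ Γ p :=
  hΓ.contDiffOn.contDiffAt (hG.isOpen.mem_nhds hp)

theorem differentiableAt (hΓ : IsChristoffel G Γ S) (hG : IsMetricOn G S) {p : V} (hp : p ∈ S) :
    DifferentiableAt ℝ Γ p :=
  (hΓ.contDiffAt hG hp).differentiableAt (by simp)

theorem symm (hΓ : IsChristoffel G Γ S) (hG : IsMetricOn G S) {p : V} (hp : p ∈ S) (u v : V) :
    Γ p u v = Γ p v u := by
  refine hG.eq_of_forall_apply_eq hp fun w ↦ ?_
  have h1 := hΓ.koszul p hp u v w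
  have h2 := hΓ.koszul p hp v u w
  rw [hG.fderiv_symm hp w v u] at h2
  linarith

/-- The metric is parallel. -/
theorem fderiv_metric (hΓ : IsChristoffel G Γ S) (hG : IsMetricOn G S) {p : V} (hp : p ∈ S)
    (u v w : V) : fderiv ℝ G p u v w = G p (Γ p u v) w + G p v (Γ p u w) := by
  have h1 := hΓ.koszul p hp u v w
  have h2 := hΓ.koszul p hp u w v
  rw [hG.fderiv_symm hp u w v] at h2
  rw [hG.symm p hp v]
  linarith

/-- Curvature operators are skew for the metric: take second derivatives of `q ↦ G q z w`. -/
theorem metric_curvatureMap (hΓ : IsChristoffel G Γ S) (hG : IsMetricOn G S) {p : V} (hp : p ∈ S)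
    (u v z w : V) :
    G p (curvatureMap Γ p v z u) w + G p z (curvatureMap Γ p v w u) = 0 := by
  have hd := hG.differentiableAt hp
  have hΓd := hΓ.differentiableAt hG hp
  let f : V → ℝ := fun q ↦ G q z w
  have hf : ContDiffAt ℝ ∞ f p :=
    ((hG.contDiffOn.contDiffAt (hG.isOpen.mem_nhds hp)).clm_apply contDiffAt_const).clm_apply
      contDiffAt_const
  have hfd : DifferentiableAt ℝ (fderiv ℝ f) p :=
    (hf.fderiv_right (m := 1) two_le_infty).differentiableAt (by simp)
  have h1 (v : V) : (fun q ↦ fderiv ℝ f q v) =ᶠ[𝓝 p]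
      fun q ↦ G q (Γ q v z) w + G q z (Γ q v w) := by
    filter_upwards [hG.isOpen.mem_nhds hp] with q hq
    have hdq := hG.differentiableAt hq
    rw [← hΓ.fderiv_metric hG hq, fderiv_clm_apply_const (hdq.clm_apply (differentiableAt_const z)),
      fderiv_clm_apply_const hdq]
  have hc (v z : V) : HasFDerivAt (fun q ↦ Γ q v z) (((fderiv ℝ Γ p).flip v).flip z) p := by
    convert! (hΓd.hasFDerivAt.clm_apply (hasFDerivAt_const v p)).clm_apply
      (hasFDerivAt_const z p) using 1
    ext; simp
  have h2 (u v : V) : fderiv ℝ (fderiv ℝ f) p u v =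
      fderiv ℝ G p u (Γ p v z) w + G p (fderiv ℝ Γ p u v z) w +
        (fderiv ℝ G p u z (Γ p v w) + G p z (fderiv ℝ Γ p u v w)) := by
    rw [← fderiv_clm_apply_const hfd, (h1 v).fderiv_eq]
    have h3 := ((hd.hasFDerivAt.clm_apply (hc v z)).clm_apply (hasFDerivAt_const w p)).add
      ((hd.hasFDerivAt.clm_apply (hasFDerivAt_const z p)).clm_apply (hc v w))
    refine (congr($(h3.fderiv) u)).trans ?_
    simp
    ring
  have h4 : fderiv ℝ (fderiv ℝ f) p u v = fderiv ℝ (fderiv ℝ f) p v u :=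
    hf.isSymmSndFDerivAt (by simpa using two_le_infty) u v
  rw [h2, h2] at h4
  simp only [hΓ.fderiv_metric hG hp] at h4
  simp only [curvatureMap_apply, map_add, map_sub, add_apply, sub_apply]
  linarith

set_option maxSynthPendingDepth 4 in
/-- The second Bianchi identity, on constant vector fields. The terms `R(∇_k i, j) z` of the
covariant derivative of the curvature cancel in the cyclic sum, by the symmetry of `Γ`, and are left
out. -/
theorem second_bianchi (hΓ : IsChristoffel G Γ S) (hG : IsMetricOn G S) {p : V} (hp : p ∈ S)
    (k i j z : V) :
    (fderiv ℝ (fun q ↦ curvatureMap Γ q j z i) p k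
        + Γ p k (curvatureMap Γ p j z i) - curvatureMap Γ p j (Γ p k z) i)
      + (fderiv ℝ (fun q ↦ curvatureMap Γ q k z j) p i
        + Γ p i (curvatureMap Γ p k z j) - curvatureMap Γ p k (Γ p i z) j)
      + (fderiv ℝ (fun q ↦ curvatureMap Γ q i z k) p j
        + Γ p j (curvatureMap Γ p i z k) - curvatureMap Γ p i (Γ p j z) k) = 0 := by
  have hΓd := hΓ.differentiableAt hG hp
  have hΓc := hΓ.contDiffAt hG hp
  have hDd : DifferentiableAt ℝ (fderiv ℝ Γ) p :=
    (hΓc.fderiv_right (m := 1) two_le_infty).differentiableAt (by simp)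
  have hsymm (u v : V) : fderiv ℝ (fderiv ℝ Γ) p u v = fderiv ℝ (fderiv ℝ Γ) p v u :=
    hΓc.isSymmSndFDerivAt (by simpa using two_le_infty) u v
  have hc (v z : V) : HasFDerivAt (fun q ↦ Γ q v z) (((fderiv ℝ Γ p).flip v).flip z) p := by
    convert! (hΓd.hasFDerivAt.clm_apply (hasFDerivAt_const v p)).clm_apply
      (hasFDerivAt_const z p) using 1
    ext; simp
  have hc1 (u : V) := hDd.hasFDerivAt.clm_apply (hasFDerivAt_const u p)
  have hc2 (u v : V) := (hc1 u).clm_apply (hasFDerivAt_const v p)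
  have hcc (u v z : V) := (hc2 u v).clm_apply (hasFDerivAt_const z p)
  have hR (i j z k : V) : fderiv ℝ (fun q ↦ curvatureMap Γ q j z i) p k =
      fderiv ℝ (fderiv ℝ Γ) p k i j z - fderiv ℝ (fderiv ℝ Γ) p k j i z
        + (fderiv ℝ Γ p k i (Γ p j z) + Γ p i (fderiv ℝ Γ p k j z))
        - (fderiv ℝ Γ p k j (Γ p i z) + Γ p j (fderiv ℝ Γ p k i z)) := by
    have h1 (i j : V) := (hΓd.hasFDerivAt.clm_apply (hasFDerivAt_const i p)).clm_apply (hc j z)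
    have h2 := (((hcc i j z).sub (hcc j i z)).add (h1 i j)).sub (h1 j i)
    refine (congr($(h2.fderiv) k)).trans ?_
    simp
    abel
  rw [hR, hR, hR]
  simp only [curvatureMap_apply, map_add, map_sub]
  rw [hsymm k i, hsymm i j, hsymm j k]
  abel

end IsChristoffel

/-- The covariant derivatives of vector fields have curvature `curvatureMap`. -/
theorem covariantDerivative_commutator {p : V} (hΓ : DifferentiableAt ℝ Γ p) {X Y Z : V → V}
    (hX : DifferentiableAt ℝ X p) (hY : DifferentiableAt ℝ Y p) (hZ : ContDiffAt ℝ 2 Z p) :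
    (fderiv ℝ (fun q ↦ fderiv ℝ Z q (Y q) + Γ q (Y q) (Z q)) p (X p)
        + Γ p (X p) (fderiv ℝ Z p (Y p) + Γ p (Y p) (Z p)))
      - (fderiv ℝ (fun q ↦ fderiv ℝ Z q (X q) + Γ q (X q) (Z q)) p (Y p)
        + Γ p (Y p) (fderiv ℝ Z p (X p) + Γ p (X p) (Z p)))
      - (fderiv ℝ Z p (fderiv ℝ Y p (X p) - fderiv ℝ X p (Y p))
        + Γ p (fderiv ℝ Y p (X p) - fderiv ℝ X p (Y p)) (Z p)) =
    curvatureMap Γ p (Y p) (Z p) (X p) := by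
  have hDd : DifferentiableAt ℝ (fderiv ℝ Z) p :=
    (hZ.fderiv_right (m := 1) (by norm_num)).differentiableAt (by simp)
  have hZd : DifferentiableAt ℝ Z p := hZ.differentiableAt (by simp)
  have hsymm (u v : V) : fderiv ℝ (fderiv ℝ Z) p u v = fderiv ℝ (fderiv ℝ Z) p v u :=
    hZ.isSymmSndFDerivAt (by simp) u v
  have h (Y : V → V) (hY : DifferentiableAt ℝ Y p) (u : V) :
      fderiv ℝ (fun q ↦ fderiv ℝ Z q (Y q) + Γ q (Y q) (Z q)) p u =
      fderiv ℝ (fderiv ℝ Z) p u (Y p) + fderiv ℝ Z p (fderiv ℝ Y p u)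
        + (fderiv ℝ Γ p u (Y p) (Z p) + Γ p (fderiv ℝ Y p u) (Z p)
          + Γ p (Y p) (fderiv ℝ Z p u)) := by
    have h1 := (hDd.hasFDerivAt.clm_apply hY.hasFDerivAt).add
      ((hΓ.hasFDerivAt.clm_apply hY.hasFDerivAt).clm_apply hZd.hasFDerivAt)
    refine (congr($(h1.fderiv) u)).trans ?_
    simp
    abel
  rw [h Y hY, h X hX, curvatureMap_apply, hsymm (X p)]
  simp only [map_add, map_sub, sub_apply]
  abel

end Christoffel

/-! ### Three-dimensional Einstein metrics and Schur's lemma -/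

section Schur

open Set

variable {V : Type*} [NormedAddCommGroup V] [NormedSpace ℝ V]

theorem exists_orthonormal_basis_of_posDef [FiniteDimensional ℝ V] {n : ℕ}
    (hn : Module.finrank ℝ V = n) (B : V →L[ℝ] V →L[ℝ] ℝ) (hsymm : ∀ u v, B u v = B v u)
    (hpos : ∀ v, v ≠ 0 → 0 < B v v) :
    ∃ e : Module.Basis (Fin n) ℝ V, ∀ i j, B (e i) (e j) = if i = j then 1 else 0 := by
  subst hn
  let B' : LinearMap.BilinForm ℝ V := LinearMap.mk₂ ℝ (fun u v ↦ B u v) (by simp) (by simp)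
    (by simp) (by simp)
  obtain ⟨b, hb⟩ := LinearMap.BilinForm.exists_orthogonal_basis (B := B')
    ⟨fun u v ↦ by simpa [B'] using hsymm u v⟩
  have hpos' (i) : 0 < B (b i) (b i) := hpos _ (b.ne_zero i)
  have hs (i) : Real.sqrt (B (b i) (b i)) ≠ 0 := (Real.sqrt_pos.2 (hpos' i)).ne'
  refine ⟨b.isUnitSMul fun i ↦ (inv_ne_zero (hs i)).isUnit, fun i j ↦ ?_⟩
  rw [Module.Basis.isUnitSMul_apply, Module.Basis.isUnitSMul_apply]
  split_ifs with h
  · subst h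
    have := Real.mul_self_sqrt (hpos' i).le
    simp only [map_smul, smul_apply, smul_eq_mul]
    field_simp [hs i]
    rw [pow_two, this]
  · have : B (b i) (b j) = 0 := LinearMap.isOrthoᵢ_def.1 hb i j h
    simp [this]

/-- In dimension three the Ricci tensor determines the curvature; if it is a multiple of the metric
then the curvature is that of a space of constant curvature. -/
theorem curvature_eq_of_trace_eq [FiniteDimensional ℝ V] (hV : Module.finrank ℝ V = 3)
    {B : V →L[ℝ] V →L[ℝ] ℝ} (hsymm : ∀ u v, B u v = B v u) (hpos : ∀ v, v ≠ 0 → 0 < B v v)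
    {R : V →ₗ[ℝ] V →ₗ[ℝ] V →ₗ[ℝ] V} (hswap : ∀ u v w, R v w u = -R u w v)
    (hskew : ∀ u v z w, B (R v z u) w + B z (R v w u) = 0) {c : ℝ}
    (htr : ∀ v w, LinearMap.trace ℝ V (R v w) = c * B v w) (u v w : V) :
    R v w u = (c / 2) • (B v w • u - B u w • v) := by
  obtain ⟨e, he⟩ := exists_orthonormal_basis_of_posDef hV B hsymm hpos
  have hexp (x : V) (i : Fin 3) : e.coord i x = B x (e i) := by
    rw [show B x (e i) = B (∑ j, e.repr x j • e j) (e i) by rw [e.sum_repr], map_sum, sum_apply]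
    simp [he]
  let r : Fin 3 → Fin 3 → Fin 3 → Fin 3 → ℝ := fun i j k l ↦ B (R (e j) (e k) (e i)) (e l)
  have h1 (i j k l) : r i j k l = -r j i k l := by simp [r, hswap (e i)]
  have h2 (i j k l) : r i j k l = -r i j l k := by
    have := hskew (e i) (e j) (e k) (e l)
    rw [hsymm (e k)] at this
    simp only [r]
    linarith
  have h3 (j k) : r 0 j k 0 + r 1 j k 1 + r 2 j k 2 = if j = k then c else 0 := by
    have := htr (e j) (e k)
    rw [LinearMap.trace_eq_matrix_trace ℝ e, Matrix.trace, Fin.sum_univ_three, he] at this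
    simp only [Matrix.diag_apply, LinearMap.toMatrix_apply] at this
    simp only [← Module.Basis.coord_apply, hexp] at this
    simp only [r, this]
    split_ifs <;> simp
  have hz1 (i k l) : r i i k l = 0 := by linarith [h1 i i k l]
  have hz2 (i j k) : r i j k k = 0 := by linarith [h2 i j k k]
  -- The Ricci tensor gives the sectional curvatures and the mixed components.
  have key (i j k l) : r i j k l =
      (c / 2) * ((if j = k then 1 else 0) * (if i = l then 1 else 0)
        - (if i = k then 1 else 0) * (if j = l then 1 else 0)) := by
    have t00 := h3 0 0
    have t11 := h3 1 1
    have t22 := h3 2 2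
    have t01 := h3 0 1
    have t02 := h3 0 2
    have t12 := h3 1 2
    have t10 := h3 1 0
    have t20 := h3 2 0
    have t21 := h3 2 1
    have s1 : r 1 0 0 1 = r 0 1 1 0 := by rw [h1, h2, neg_neg]
    have s2 : r 2 0 0 2 = r 0 2 2 0 := by rw [h1, h2, neg_neg]
    have s3 : r 2 1 1 2 = r 1 2 2 1 := by rw [h1, h2, neg_neg]
    simp only [hz1, hz2, s1, s2, s3] at t00 t11 t22 t01 t02 t12 t10 t20 t21
    simp at t00 t11 t22 t01 t02 t12 t10 t20 t21
    -- By the antisymmetries each component vanishes or is one of the components in the above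
    -- equations.
    have a1 := h1 i j k l
    have a2 := h2 i j k l
    have a3 := h2 j i k l
    clear h3 hskew hswap htr
    fin_cases i <;> fin_cases j <;> fin_cases k <;> fin_cases l <;>
      simp [hz1, hz2] at a1 a2 a3 ⊢ <;> linarith
  have hR : R = LinearMap.mk₂ ℝ (fun v w ↦ (c / 2) • ((B v w) • LinearMap.id
      - LinearMap.smulRight ((B.flip w : V →L[ℝ] ℝ) : V →ₗ[ℝ] ℝ) v))
      (fun _ _ _ ↦ by ext; simp; module)
      (fun _ _ _ ↦ by ext; simp; module)
      (fun _ _ _ ↦ by ext; simp; module)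
      (fun _ _ _ ↦ by ext; simp; module) := by
    refine e.ext fun j ↦ e.ext fun k ↦ e.ext fun i ↦ e.ext_elem fun l ↦ ?_
    rw [← Module.Basis.coord_apply, ← Module.Basis.coord_apply, hexp, hexp]
    refine (key i j k l).trans ?_
    simp [he, -ite_smul]
  rw [hR]
  simp

variable {G : V → V →L[ℝ] V →L[ℝ] ℝ} {Γ : V → V →L[ℝ] V →L[ℝ] V} {S : Set V}

/-- Schur's lemma: by the second Bianchi identity, the derivative of the curvature of a metric of
pointwise constant curvature vanishes on linearly independent triples of vectors. -/
theorem IsChristoffel.fderiv_sectionalCurvature_eq_zero (hΓ : IsChristoffel G Γ S)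
    (hG : IsMetricOn G S) {K : V → ℝ} {p : V} (hp : p ∈ S) (hK : DifferentiableAt ℝ K p)
    (hR : ∀ q ∈ S, ∀ u v w, curvatureMap Γ q v w u = K q • (G q v w • u - G q u w • v))
    {k i j : V} (hind : LinearIndependent ℝ ![k, i, j]) : fderiv ℝ K p k = 0 := by
  have hd := hG.differentiableAt hp
  have hD (i j z k : V) : fderiv ℝ (fun q ↦ curvatureMap Γ q j z i) p k =
      fderiv ℝ K p k • (G p j z • i - G p i z • j)
        + K p • (fderiv ℝ G p k j z • i - fderiv ℝ G p k i z • j) := by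
    have h1 : (fun q ↦ curvatureMap Γ q j z i) =ᶠ[𝓝 p]
        fun q ↦ K q • (G q j z • i - G q i z • j) := by
      filter_upwards [hG.isOpen.mem_nhds hp] with q hq using hR q hq i j z
    have h2 (j : V) := (hd.hasFDerivAt.clm_apply (hasFDerivAt_const j p)).clm_apply
      (hasFDerivAt_const z p)
    have h3 := hK.hasFDerivAt.smul (((h2 j).smul_const i).sub ((h2 i).smul_const j))
    rw [h1.fderiv_eq]
    refine (congr($(h3.fderiv) k)).trans ?_
    simp
    abel
  have hB (z : V) : (fderiv ℝ K p i * G p j z - fderiv ℝ K p j * G p i z) • k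
      + (fderiv ℝ K p j * G p k z - fderiv ℝ K p k * G p j z) • i
      + (fderiv ℝ K p k * G p i z - fderiv ℝ K p i * G p k z) • j = 0 := by
    have h := hΓ.second_bianchi hG hp k i j z
    simp only [hD, hR p hp, hΓ.fderiv_metric hG hp, hΓ.symm hG hp i k, hΓ.symm hG hp j i,
      hΓ.symm hG hp j k, map_smul, map_sub] at h
    rw [← neg_eq_zero, ← h]
    module
  have hco (z : V) : G p (fderiv ℝ K p j • k - fderiv ℝ K p k • j) z = 0 := by
    have h := Fintype.linearIndependent_iff.1 hind
      ![fderiv ℝ K p i * G p j z - fderiv ℝ K p j * G p i z,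
        fderiv ℝ K p j * G p k z - fderiv ℝ K p k * G p j z,
        fderiv ℝ K p k * G p i z - fderiv ℝ K p i * G p k z]
      (by rw [← hB z, Fin.sum_univ_three]; rfl) 1
    simpa using h
  have hzero := hG.nondegenerate p hp _ hco
  have h := Fintype.linearIndependent_iff.1 hind
    ![fderiv ℝ K p j, 0, -fderiv ℝ K p k]
    (by rw [← hzero, Fin.sum_univ_three]; simp [sub_eq_add_neg]) 2
  simpa using h

/-- Schur's lemma for the Ricci tensor, in dimension three. -/
theorem IsChristoffel.fderiv_ricci_factor_eq_zero [FiniteDimensional ℝ V]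
    (hV : Module.finrank ℝ V = 3) (hΓ : IsChristoffel G Γ S) (hG : IsMetricOn G S)
    (hpos : ∀ p ∈ S, ∀ v, v ≠ 0 → 0 < G p v v) {c : V → ℝ}
    (hc : ∀ p ∈ S, DifferentiableAt ℝ c p)
    (htr : ∀ p ∈ S, ∀ v w, LinearMap.trace ℝ V (curvatureMap Γ p v w) = c p * G p v w)
    {p : V} (hp : p ∈ S) : fderiv ℝ c p = 0 := by
  have hR (q) (hq : q ∈ S) (u v w : V) :
      curvatureMap Γ q v w u = (c q / 2) • (G q v w • u - G q u w • v) :=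
    curvature_eq_of_trace_eq hV (hG.symm q hq) (hpos q hq)
      (R := LinearMap.mk₂ ℝ (fun v w ↦ curvatureMap Γ q v w)
        (fun _ _ _ ↦ by ext; simp [curvatureMap_apply]; abel)
        (fun _ _ _ ↦ by ext; simp [curvatureMap_apply, smul_sub, smul_add])
        (fun _ _ _ ↦ by ext; simp [curvatureMap_apply]; abel)
        (fun _ _ _ ↦ by ext; simp [curvatureMap_apply, smul_sub, smul_add]))
      (fun u v w ↦ curvatureMap_swap Γ q u v w)
      (fun u v z w ↦ hΓ.metric_curvatureMap hG hq u v z w) (htr q hq) u v w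
  have hK : DifferentiableAt ℝ (fun q ↦ c q / 2) p := by
    simpa only [div_eq_mul_inv] using (hc p hp).mul_const (2 : ℝ)⁻¹
  obtain ⟨e, -⟩ := exists_orthonormal_basis_of_posDef hV (G p) (hG.symm p hp) (hpos p hp)
  have h1 (k i j : Fin 3) (hki : k ≠ i) (hij : i ≠ j) (hkj : k ≠ j) : fderiv ℝ c p (e k) = 0 := by
    have hind : LinearIndependent ℝ ![e k, e i, e j] := by
      have h2 := e.linearIndependent.comp ![k, i, j] (by
        intro a b hab
        fin_cases a <;> fin_cases b <;> simp_all [eq_comm])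
      convert! h2 using 1
      ext a
      fin_cases a <;> rfl
    have h3 := hΓ.fderiv_sectionalCurvature_eq_zero hG hp hK hR hind
    simp only [div_eq_mul_inv] at h3
    rw [((hc p hp).hasFDerivAt.mul_const (2 : ℝ)⁻¹).fderiv] at h3
    simpa using h3
  refine ContinuousLinearMap.coe_injective (e.ext fun k ↦ ?_)
  fin_cases k
  · exact h1 0 1 2 (by decide) (by decide) (by decide)
  · exact h1 1 0 2 (by decide) (by decide) (by decide)
  · exact h1 2 0 1 (by decide) (by decide) (by decide)

end Schur

/-! ### Local splitting along a parallel unit vector field -/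

section Splitting

open Set Metric

variable {E : Type*} [NormedAddCommGroup E] [NormedSpace ℝ E]
  {G : E → E →L[ℝ] E →L[ℝ] ℝ} {Γ : E → E →L[ℝ] E →L[ℝ] E} {S : Set E} {ρ : E → E}

/-- The 1-form metrically dual to a parallel vector field is closed. -/
theorem fderiv_dual_of_parallel (hG : IsMetricOn G S) (hΓ : IsChristoffel G Γ S)
    (hρ : ContDiffOn ℝ ∞ ρ S) (hpar : ∀ p ∈ S, ∀ u, fderiv ℝ ρ p u + Γ p u (ρ p) = 0)
    {p : E} (hp : p ∈ S) (u v : E) :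
    fderiv ℝ (fun q ↦ G q (ρ q)) p u v = fderiv ℝ (fun q ↦ G q (ρ q)) p v u := by
  have hρd : DifferentiableAt ℝ ρ p :=
    (hρ.contDiffAt (hG.isOpen.mem_nhds hp)).differentiableAt (by simp)
  have h (u v : E) : fderiv ℝ (fun q ↦ G q (ρ q)) p u v = G p (ρ p) (Γ p u v) := by
    rw [fderiv_clm_apply (hG.differentiableAt hp) hρd]
    simp [hΓ.fderiv_metric hG hp, eq_neg_of_add_eq_zero_left (hpar p hp u)]
  rw [h, h, hΓ.symm hG hp]

variable {F : Type*} [NormedAddCommGroup F] [NormedSpace ℝ F]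

/-- In coordinates `ψ (t, y)` in which the parallel field `ρ` is `∂/∂t` and its dual 1-form is
`-dt`, the metric is `-dt²` plus a metric in the variable `y` that does not depend on `t`, since
the flow of `ρ` consists of isometries. -/
theorem metric_comp_of_parallel (hG : IsMetricOn G S) (hΓ : IsChristoffel G Γ S)
    (hρ : ContDiffOn ℝ ∞ ρ S) (hpar : ∀ p ∈ S, ∀ u, fderiv ℝ ρ p u + Γ p u (ρ p) = 0)
    (hunit : ∀ p ∈ S, G p (ρ p) (ρ p) = -1) {ε : ℝ} (hε : 0 < ε) {ψ : ℝ × F → E}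
    (hψ : ContDiffOn ℝ ∞ ψ (ball 0 ε ×ˢ univ)) (hmaps : MapsTo ψ (ball 0 ε ×ˢ univ) S)
    (hψρ : ∀ p ∈ ball 0 ε ×ˢ univ, fderiv ℝ ψ p (1, 0) = ρ (ψ p))
    (hψA : ∀ p ∈ ball 0 ε ×ˢ univ, ∀ v, G (ψ p) (ρ (ψ p)) (fderiv ℝ ψ p v) = -v.1)
    {t : ℝ} (ht : t ∈ ball 0 ε) (q : F) (v w : ℝ × F) :
    G (ψ (t, q)) (fderiv ℝ ψ (t, q) v) (fderiv ℝ ψ (t, q) w) =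
      -(v.1 * w.1) + G (ψ (0, q)) (fderiv ℝ ψ (0, q) (0, v.2)) (fderiv ℝ ψ (0, q) (0, w.2)) := by
  have hU : IsOpen (ball (0 : ℝ) ε ×ˢ (univ : Set F)) := isOpen_ball.prod isOpen_univ
  have hmem (s : ℝ) (hs : s ∈ ball 0 ε) : (s, q) ∈ ball (0 : ℝ) ε ×ˢ (univ : Set F) :=
    ⟨hs, mem_univ _⟩
  let k : F → F → ℝ → ℝ := fun u w s ↦
    G (ψ (s, q)) (fderiv ℝ ψ (s, q) (0, u)) (fderiv ℝ ψ (s, q) (0, w))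
  -- The components of the metric along the fibre do not depend on `s`: the mixed second derivative
  -- of `ψ` is the derivative of `ρ`, which is `-Γ` since `ρ` is parallel, and `G` is parallel too.
  have hk (u w : F) (s : ℝ) (hs : s ∈ ball 0 ε) : HasDerivAt (k u w) 0 s := by
    have hp := hmem s hs
    have hpS := hmaps hp
    have hψc : ContDiffAt ℝ ∞ ψ (s, q) := hψ.contDiffAt (hU.mem_nhds hp)
    have hψd : DifferentiableAt ℝ ψ (s, q) := hψc.differentiableAt (by simp)
    have hDd : DifferentiableAt ℝ (fderiv ℝ ψ) (s, q) :=
      (hψc.fderiv_right (m := 1) two_le_infty).differentiableAt (by simp)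
    have hρd : DifferentiableAt ℝ ρ (ψ (s, q)) :=
      (hρ.contDiffAt (hG.isOpen.mem_nhds hpS)).differentiableAt (by simp)
    have hι : HasDerivAt (fun s : ℝ ↦ (s, q)) ((1 : ℝ), (0 : F)) s :=
      (hasDerivAt_id s).prodMk (hasDerivAt_const s q)
    have h1 : HasDerivAt (fun s ↦ ψ (s, q)) (ρ (ψ (s, q))) s := by
      rw [← hψρ _ hp]
      exact HasFDerivAt.comp_hasDerivAt (f := fun s : ℝ ↦ (s, q)) (l := ψ) s hψd.hasFDerivAt hι
    have hDι : HasDerivAt (fun s ↦ fderiv ℝ ψ (s, q))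
        (fderiv ℝ (fderiv ℝ ψ) (s, q) (1, 0)) s :=
      HasFDerivAt.comp_hasDerivAt (f := fun s : ℝ ↦ (s, q)) (l := fderiv ℝ ψ) s hDd.hasFDerivAt hι
    have hGι : HasDerivAt (fun s ↦ G (ψ (s, q))) (fderiv ℝ G (ψ (s, q)) (ρ (ψ (s, q)))) s :=
      HasFDerivAt.comp_hasDerivAt (f := fun s : ℝ ↦ ψ (s, q)) (l := G) s
        (hG.differentiableAt hpS).hasFDerivAt h1
    have h2 (u : F) : HasDerivAt (fun s ↦ fderiv ℝ ψ (s, q) (0, u))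
        (-Γ (ψ (s, q)) (fderiv ℝ ψ (s, q) (0, u)) (ρ (ψ (s, q)))) s := by
      have h3 := hDι.clm_apply (hasDerivAt_const s ((0 : ℝ), u))
      refine h3.congr_deriv ?_
      have h4 : (fun p ↦ fderiv ℝ ψ p (1, 0)) =ᶠ[𝓝 (s, q)] ρ ∘ ψ := by
        filter_upwards [hU.mem_nhds hp] with p hp using hψρ p hp
      have h5 : fderiv ℝ (fderiv ℝ ψ) (s, q) (0, u) (1, 0) =
          fderiv ℝ ρ (ψ (s, q)) (fderiv ℝ ψ (s, q) (0, u)) := by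
        rw [← fderiv_clm_apply_const hDd, h4.fderiv_eq, fderiv_comp _ hρd hψd]
        rfl
      have h6 : fderiv ℝ (fderiv ℝ ψ) (s, q) (1, 0) (0, u) =
          fderiv ℝ (fderiv ℝ ψ) (s, q) (0, u) (1, 0) :=
        hψc.isSymmSndFDerivAt (by simpa using two_le_infty) _ _
      rw [map_zero, add_zero, h6, h5]
      exact eq_neg_of_add_eq_zero_left (hpar _ hpS _)
    have h7 := (hGι.clm_apply (h2 u)).clm_apply (h2 w)
    refine h7.congr_deriv ?_
    simp only [add_apply, hΓ.fderiv_metric hG hpS, map_neg, neg_apply,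
      hΓ.symm hG hpS (ρ (ψ (s, q)))]
    ring
  have hconst (u w : F) : k u w t = k u w 0 :=
    isOpen_ball.is_const_of_deriv_eq_zero (convex_ball (0 : ℝ) ε).isPreconnected
      (fun s hs ↦ (hk u w s hs).differentiableAt.differentiableWithinAt)
      (fun s hs ↦ (hk u w s hs).deriv) ht (mem_ball_self hε)
  have hp := hmem t ht
  have hdec (v : ℝ × F) : fderiv ℝ ψ (t, q) v =
      v.1 • ρ (ψ (t, q)) + fderiv ℝ ψ (t, q) (0, v.2) := by
    rw [← hψρ _ hp, ← map_smul, ← map_add]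
    simp
  have hA (u : F) : G (ψ (t, q)) (ρ (ψ (t, q))) (fderiv ℝ ψ (t, q) (0, u)) = 0 := by
    simpa using hψA _ hp (0, u)
  have h8 := hconst v.2 w.2
  simp only [k] at h8
  rw [hdec v, hdec w, ← h8]
  simp only [map_add, map_smul, add_apply, smul_apply, smul_eq_mul, hA,
    hG.symm _ (hmaps hp) (fderiv ℝ ψ (t, q) (0, v.2)) (ρ (ψ (t, q))), hunit _ (hmaps hp)]
  ring

/-- A vector field that is smooth near a point agrees near that point with a globally smooth
one. -/
theorem exists_contDiff_eqOn_ball [FiniteDimensional ℝ E] {p₀ : E} {r : ℝ} (hr : 0 < r)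
    {X : E → F} (hX : ContDiffOn ℝ ∞ X (ball p₀ r)) :
    ∃ Y : E → F, ContDiff ℝ ∞ Y ∧ EqOn Y X (ball p₀ (r / 3)) := by
  let χ : ContDiffBump p₀ := ⟨r / 3, r / 2, by positivity, by linarith⟩
  refine ⟨fun x ↦ χ x • X x, contDiff_iff_contDiffAt.2 fun x ↦ ?_, fun x hx ↦ ?_⟩
  · by_cases hx : x ∈ ball p₀ r
    · exact χ.contDiffAt.smul (hX.contDiffAt (isOpen_ball.mem_nhds hx))
    · have hx' : x ∈ (tsupport χ)ᶜ := by
        rw [χ.tsupport_eq]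
        intro h
        exact hx (closedBall_subset_ball (by change r / 2 < r; linarith) h)
      refine (contDiffAt_const (c := (0 : F))).congr_of_eventuallyEq ?_
      filter_upwards [(isClosed_tsupport _).isOpen_compl.mem_nhds hx'] with y hy
      rw [image_eq_zero_of_notMem_tsupport hy, zero_smul]
  · simp only
    rw [χ.one_of_mem_closedBall (ball_subset_closedBall hx), one_smul]

/-- Coordinates adapted to a parallel unit timelike vector field `ρ` near a point: move the points
of a hyperplane orthogonal to `ρ` along the flow of `ρ`, for a time corrected by a primitive `f` of
the dual 1-form, so that the new time function is `-f` up to a constant. The fibre variable, which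
at first ranges over a ball, is reparametrized by the whole space. -/
theorem exists_splitting_coordinates {E : Type*} [NormedAddCommGroup E] [NormedSpace ℝ E]
    [FiniteDimensional ℝ E] {F : Type*} [NormedAddCommGroup F] [InnerProductSpace ℝ F]
    [FiniteDimensional ℝ F] (hdim : Module.finrank ℝ F + 1 = Module.finrank ℝ E)
    {G : E → E →L[ℝ] E →L[ℝ] ℝ} {Γ : E → E →L[ℝ] E →L[ℝ] E} {S : Set E} {ρ : E → E}
    (hG : IsMetricOn G S) (hΓ : IsChristoffel G Γ S)
    (hρ : ContDiffOn ℝ ∞ ρ S) (hpar : ∀ p ∈ S, ∀ u, fderiv ℝ ρ p u + Γ p u (ρ p) = 0)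
    (hunit : ∀ p ∈ S, G p (ρ p) (ρ p) = -1) {p₀ : E} (hp₀ : p₀ ∈ S) :
    ∃ ε > 0, ∃ ψ : OpenPartialHomeomorph (ℝ × F) E, ψ.source = ball 0 ε ×ˢ univ ∧
      p₀ ∈ ψ.target ∧ ψ.target ⊆ S ∧ ContDiffOn ℝ ∞ ψ ψ.source ∧
      ContDiffOn ℝ ∞ ψ.symm ψ.target ∧
      (∀ p ∈ ψ.source, fderiv ℝ ψ p (1, 0) = ρ (ψ p)) ∧
      ∀ p ∈ ψ.source, ∀ v, G (ψ p) (ρ (ψ p)) (fderiv ℝ ψ p v) = -v.1 := by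
  -- A primitive `f` of the dual 1-form.
  obtain ⟨r, hr, hrS⟩ := Metric.isOpen_iff.1 hG.isOpen p₀ hp₀
  have hA : ContDiffOn ℝ ∞ (fun q ↦ G q (ρ q)) (ball p₀ r) :=
    (hG.contDiffOn.clm_apply hρ).mono hrS
  obtain ⟨f, hf⟩ := (convex_ball p₀ r).exists_forall_hasFDerivAt_of_fderiv_symmetric isOpen_ball
    (hA.differentiableOn (by simp))
    (fun a ha ↦ fderiv_dual_of_parallel hG hΓ hρ hpar (hrS ha))
  have hfc : ContDiffOn ℝ ∞ f (ball p₀ r) :=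
    (contDiffOn_infty_iff_fderiv_of_isOpen isOpen_ball).2
      ⟨fun a ha ↦ (hf a ha).differentiableAt.differentiableWithinAt,
        hA.congr fun a ha ↦ (hf a ha).fderiv⟩
  -- The flow `Θ` of `ρ`.
  obtain ⟨v, hv, hvρ⟩ := exists_contDiff_eqOn_ball hr (hρ.mono hrS)
  obtain ⟨ε₁, hε₁, Θ, hΘ, hΘ'⟩ := exists_contDiffOn_local_flow hv p₀
  have hΘ0 : Θ (0, p₀) = p₀ := (hΘ' p₀ (mem_ball_self hε₁)).1
  have hr3 : 0 < r / 3 := by positivity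
  have h0mem : ((0 : ℝ), p₀) ∈ ball (0 : ℝ) ε₁ ×ˢ ball p₀ ε₁ :=
    ⟨mem_ball_self hε₁, mem_ball_self hε₁⟩
  have hΘcont : ContinuousAt Θ (0, p₀) :=
    (hΘ.contDiffAt ((isOpen_ball.prod isOpen_ball).mem_nhds h0mem)).continuousAt
  have hev : ∀ᶠ z in 𝓝 ((0 : ℝ), p₀), Θ z ∈ ball p₀ (r / 3) :=
    hΘcont.eventually_mem (by rw [hΘ0]; exact ball_mem_nhds _ hr3)
  obtain ⟨ε₂', hε₂', hΘball'⟩ := Metric.eventually_nhds_iff_ball.1 hev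
  let ε₂ := min (min ε₁ ε₂') (r / 3)
  have hε₂ : 0 < ε₂ := by positivity
  have hε₂₁ : ε₂ ≤ ε₁ := (min_le_left _ _).trans (min_le_left _ _)
  have hε₂₂ : ε₂ ≤ ε₂' := (min_le_left _ _).trans (min_le_right _ _)
  have hε₂r : ε₂ ≤ r := (min_le_right _ _).trans (by linarith)
  let B : Set (ℝ × E) := ball 0 ε₂ ×ˢ ball p₀ ε₂
  have hB : IsOpen B := isOpen_ball.prod isOpen_ball
  have hΘB : ContDiffOn ℝ ∞ Θ B :=
    hΘ.mono (prod_mono (ball_subset_ball hε₂₁) (ball_subset_ball hε₂₁))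
  have hΘball : ∀ z ∈ B, Θ z ∈ ball p₀ (r / 3) := fun z hz ↦ hΘball' z (by
    rw [← ball_prod_same]
    exact prod_mono (ball_subset_ball hε₂₂) (ball_subset_ball hε₂₂) hz)
  have hr3r : ball p₀ (r / 3) ⊆ ball p₀ r := ball_subset_ball (by linarith)
  have hΘd : ∀ x ∈ ball p₀ ε₂, ∀ s ∈ ball (0 : ℝ) ε₂,
      HasDerivAt (fun s ↦ Θ (s, x)) (ρ (Θ (s, x))) s := by
    intro x hx s hs
    rw [← hvρ (hΘball (s, x) ⟨hs, hx⟩)]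
    exact (hΘ' x (ball_subset_ball hε₂₁ hx)).2 s (ball_subset_ball hε₂₁ hs)
  -- The primitive decreases at unit rate along the flow, as `G(ρ, ρ) = -1`.
  have hfΘ : ∀ x ∈ ball p₀ ε₂, ∀ s ∈ ball (0 : ℝ) ε₂, f (Θ (s, x)) = f x - s := by
    intro x hx s hs
    have h1 : ∀ s ∈ ball (0 : ℝ) ε₂, HasDerivAt (fun s ↦ f (Θ (s, x)) + s) 0 s := by
      intro s hs
      have hmem := hr3r (hΘball (s, x) ⟨hs, hx⟩)
      have h2 := ((hf _ hmem).comp_hasDerivAt s (hΘd x hx s hs)).add (hasDerivAt_id s)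
      refine h2.congr_deriv ?_
      rw [hunit _ (hrS hmem)]
      norm_num
    have h3 := isOpen_ball.is_const_of_deriv_eq_zero (convex_ball (0 : ℝ) ε₂).isPreconnected
      (fun s hs ↦ (h1 s hs).differentiableAt.differentiableWithinAt)
      (fun s hs ↦ (h1 s hs).deriv) hs (mem_ball_self hε₂)
    simp only [(hΘ' x (ball_subset_ball hε₂₁ hx)).1] at h3
    linarith
  -- A hyperplane orthogonal to `ρ` at `p₀`.
  obtain ⟨σ₀, hσinj, hσA⟩ : ∃ σ₀ : F →L[ℝ] E, Function.Injective σ₀ ∧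
      ∀ u, G p₀ (ρ p₀) (σ₀ u) = 0 := by
    let A : E →ₗ[ℝ] ℝ := (G p₀ (ρ p₀) : E →L[ℝ] ℝ)
    have hA0 : A ≠ 0 := fun h ↦ by
      have h1 : A (ρ p₀) = -1 := hunit p₀ hp₀
      rw [h] at h1
      norm_num at h1
    have hker := Module.Dual.finrank_ker_add_one_of_ne_zero hA0
    let e : F ≃ₗ[ℝ] LinearMap.ker A := LinearEquiv.ofFinrankEq _ _ (by omega)
    refine ⟨LinearMap.toContinuousLinearMap ((LinearMap.ker A).subtype ∘ₗ e.toLinearMap),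
      fun a b hab ↦ e.injective (Subtype.ext hab), fun u ↦ (e u).2⟩
  let σ : F → E := fun y ↦ p₀ + σ₀ y
  have hσ : ContDiff ℝ ∞ σ := contDiff_const.add σ₀.contDiff
  have hσ0 : σ 0 = p₀ := by simp [σ]
  have hσd (y : F) : HasFDerivAt σ σ₀ y := σ₀.hasFDerivAt.const_add p₀
  let b : F → ℝ := fun y ↦ f (σ y) - f p₀
  have hb0 : b 0 = 0 := by simp [b, hσ0]
  have hbd : HasFDerivAt b ((G p₀ (ρ p₀) : E →L[ℝ] ℝ).comp σ₀) 0 := by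
    have h1 : HasFDerivAt f (G p₀ (ρ p₀)) (σ 0) := by
      rw [hσ0]; exact hf p₀ (mem_ball_self hr)
    exact (h1.comp 0 (hσd 0)).sub_const _
  have hb : ContDiffOn ℝ ∞ b (σ ⁻¹' ball p₀ r) :=
    (hfc.comp hσ.contDiffOn fun y hy ↦ hy).sub contDiffOn_const
  let j : ℝ × F → ℝ × E := fun z ↦ (z.1 + b z.2, σ z.2)
  have hj0 : j 0 = (0, p₀) := by simp [j, hb0, hσ0]
  have hjc : ContinuousAt j 0 := by
    have h1 : ContinuousAt b (0 : ℝ × F).2 := hbd.continuousAt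
    exact (continuous_fst.continuousAt.add (h1.comp continuous_snd.continuousAt)).prodMk
      (hσ.continuous.comp continuous_snd).continuousAt
  have hjev : ∀ᶠ z in 𝓝 (0 : ℝ × F), j z ∈ B :=
    hjc.eventually_mem (by
      rw [hj0]; exact hB.mem_nhds ⟨mem_ball_self hε₂, mem_ball_self hε₂⟩)
  obtain ⟨ε₃, hε₃, hjB⟩ := Metric.eventually_nhds_iff_ball.1 hjev
  let U : Set (ℝ × F) := ball 0 ε₃
  have hj : ContDiffOn ℝ ∞ j U := by
    have h1 : ContDiffOn ℝ ∞ (fun z : ℝ × F ↦ b z.2) U :=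
      hb.comp contDiffOn_snd fun z hz ↦ ball_subset_ball hε₂r (hjB z hz).2
    exact (contDiffOn_fst.add h1).prodMk (hσ.comp contDiff_snd).contDiffOn
  let Ψ : ℝ × F → E := fun z ↦ Θ (j z)
  have hΨ : ContDiffOn ℝ ∞ Ψ U := hΘB.comp hj hjB
  have hU : IsOpen U := isOpen_ball
  have hΨd (z) (hz : z ∈ U) : HasFDerivAt Ψ (fderiv ℝ Ψ z) z :=
    ((hΨ.contDiffAt (hU.mem_nhds hz)).differentiableAt (by simp)).hasFDerivAt
  have hΨS (z) (hz : z ∈ U) : Ψ z ∈ ball p₀ r := hr3r (hΘball _ (hjB z hz))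
  have hΨρ (z) (hz : z ∈ U) : fderiv ℝ Ψ z (1, 0) = ρ (Ψ z) := by
    have hι : HasDerivAt (fun s : ℝ ↦ (s, z.2)) ((1 : ℝ), (0 : F)) z.1 :=
      (hasDerivAt_id z.1).prodMk (hasDerivAt_const z.1 z.2)
    have h1 : HasDerivAt (fun s : ℝ ↦ Ψ (s, z.2)) (fderiv ℝ Ψ z (1, 0)) z.1 :=
      HasFDerivAt.comp_hasDerivAt (f := fun s : ℝ ↦ (s, z.2)) (l := Ψ) z.1 (hΨd z hz) hι
    have h2 : HasDerivAt (fun s : ℝ ↦ Ψ (s, z.2)) (ρ (Ψ z)) z.1 :=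
      (hΘd _ (hjB z hz).2 _ (hjB z hz).1).comp_add_const z.1 (b z.2)
    exact h1.unique h2
  have hfΨ (z) (hz : z ∈ U) : f (Ψ z) = f p₀ - z.1 := by
    change f (Θ (z.1 + b z.2, σ z.2)) = _
    rw [hfΘ _ (hjB z hz).2 _ (hjB z hz).1]
    change f (σ z.2) - (z.1 + (f (σ z.2) - f p₀)) = _
    ring
  have hΨA (z) (hz : z ∈ U) (w : ℝ × F) : G (Ψ z) (ρ (Ψ z)) (fderiv ℝ Ψ z w) = -w.1 := by
    have h1 : HasFDerivAt (fun z ↦ f (Ψ z)) _ z := (hf _ (hΨS z hz)).comp z (hΨd z hz)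
    have h2 : HasFDerivAt (fun z : ℝ × F ↦ f p₀ - z.1) (-ContinuousLinearMap.fst ℝ ℝ F) z :=
      hasFDerivAt_fst.const_sub _
    have h3 : (fun z ↦ f (Ψ z)) =ᶠ[𝓝 z] fun z : ℝ × F ↦ f p₀ - z.1 := by
      filter_upwards [hU.mem_nhds hz] with z hz using hfΨ z hz
    exact congr($(h1.unique (h2.congr_of_eventuallyEq h3)) w)
  have h0U : (0 : ℝ × F) ∈ U := mem_ball_self hε₃
  have hΨ0 : Ψ 0 = p₀ := by simp only [Ψ]; rw [hj0, hΘ0]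
  -- On the hyperplane, the derivative at the origin is the inclusion of its direction.
  have hΨσ (u : F) : fderiv ℝ Ψ 0 (0, u) = σ₀ u := by
    have h1 : HasFDerivAt (fun y : F ↦ (-b y, y))
        ((-((G p₀ (ρ p₀) : E →L[ℝ] ℝ).comp σ₀)).prod (ContinuousLinearMap.id ℝ F)) 0 :=
      hbd.neg.prodMk (hasFDerivAt_id 0)
    have h2 : ((-b 0, 0) : ℝ × F) = 0 := by rw [hb0, neg_zero]; rfl
    have h3 : HasFDerivAt (fun y : F ↦ Ψ (-b y, y)) _ 0 :=
      HasFDerivAt.comp (g := Ψ) 0 (by rw [h2]; exact hΨd 0 h0U) h1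
    have h4 : (fun y : F ↦ Ψ (-b y, y)) =ᶠ[𝓝 0] σ := by
      have h5 : ContinuousAt σ 0 := hσ.continuous.continuousAt
      filter_upwards [h5.eventually_mem (by rw [hσ0]; exact ball_mem_nhds p₀ hε₁)] with y hy
      simp only [Ψ, j, neg_add_cancel]
      exact (hΘ' _ hy).1
    have h6 := congr($(h3.unique ((hσd 0).congr_of_eventuallyEq h4)) u)
    simpa [hσA] using h6
  have hinj : Function.Injective (fderiv ℝ Ψ 0 : ℝ × F →ₗ[ℝ] E) := by
    rw [injective_iff_map_eq_zero]
    rintro ⟨a, u⟩ h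
    have h1 : fderiv ℝ Ψ 0 (a, u) = 0 := h
    have ha : a = 0 := by
      have := hΨA 0 h0U (a, u)
      rw [h1, map_zero] at this
      simpa using this.symm
    subst ha
    rw [hΨσ] at h1
    rw [(map_eq_zero_iff σ₀ hσinj).1 h1]
    rfl
  let e' : (ℝ × F) ≃L[ℝ] E := (LinearEquiv.ofInjectiveOfFinrankEq
    (fderiv ℝ Ψ 0 : ℝ × F →ₗ[ℝ] E) hinj (by
      rw [Module.finrank_prod, Module.finrank_self, add_comm, hdim])).toContinuousLinearEquiv
  have he' : HasFDerivAt Ψ (e' : ℝ × F →L[ℝ] E) 0 := by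
    convert! hΨd 0 h0U using 1
  obtain ⟨e, heΨ, he0, heU, hesymm⟩ :=
    exists_openPartialHomeomorph_contDiffOn_symm hU hΨ h0U he'
  obtain ⟨ε, hε, hεe⟩ := Metric.isOpen_iff.1 e.open_source 0 he0
  -- Restrict to a box, and stretch its second factor to the whole space.
  let κ : OpenPartialHomeomorph (ℝ × F) (ℝ × F) :=
    (OpenPartialHomeomorph.ofSet (ball 0 ε) isOpen_ball).prod (OpenPartialHomeomorph.univBall 0 ε)
  have hκs : κ.source = ball 0 ε ×ˢ univ := by simp [κ]
  have hκt : κ.target = ball 0 ε ×ˢ ball 0 ε := by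
    simp [κ, OpenPartialHomeomorph.univBall_target (0 : F) hε]
  have hκe : MapsTo κ κ.source e.source := fun z hz ↦ hεe (by
    rw [show (0 : ℝ × F) = (0, 0) from rfl, ← ball_prod_same, ← hκt]
    exact κ.map_source hz)
  have hκ (z : ℝ × F) : κ z = (z.1, OpenPartialHomeomorph.univBall 0 ε z.2) := rfl
  have hκc : ContDiff ℝ ∞ κ :=
    contDiff_fst.prodMk (OpenPartialHomeomorph.contDiff_univBall.comp contDiff_snd)
  have hκsymm : ContDiffOn ℝ ∞ κ.symm κ.target := by
    rw [hκt]
    exact contDiffOn_fst.prodMk (OpenPartialHomeomorph.contDiffOn_univBall_symm.comp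
      contDiffOn_snd fun z hz ↦ hz.2)
  let ψ := κ.trans e
  have hψs : ψ.source = κ.source := by
    rw [OpenPartialHomeomorph.trans_source]
    exact inter_eq_left.2 hκe
  have hψe (z) : ψ z = Ψ (κ z) := by
    rw [← heΨ]; rfl
  have hκU (z) (hz : z ∈ ψ.source) : κ z ∈ U := heU (hκe (hψs ▸ hz))
  have hκd (z) : HasFDerivAt κ (fderiv ℝ κ z) z := (hκc.differentiable (by simp) z).hasFDerivAt
  have hκ1 (z : ℝ × F) (w : ℝ × F) : (fderiv ℝ κ z w).1 = w.1 := by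
    have h1 : HasFDerivAt (fun z ↦ (κ z).1) _ z := (hκd z).fst
    exact congr($(h1.unique hasFDerivAt_fst) w)
  have hψd (z) (hz : z ∈ ψ.source) (w : ℝ × F) :
      fderiv ℝ ψ z w = fderiv ℝ Ψ (κ z) (fderiv ℝ κ z w) := by
    have h1 : (ψ : ℝ × F → E) = Ψ ∘ κ := funext hψe
    rw [h1, ((hΨd _ (hκU z hz)).comp z (hκd z)).fderiv]
    rfl
  refine ⟨ε, hε, ψ, hψs.trans hκs, ?_, ?_, ?_, ?_, fun z hz ↦ ?_, fun z hz w ↦ ?_⟩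
  · have h1 : (0 : ℝ × F) ∈ ψ.source := by
      rw [hψs, hκs]; exact ⟨mem_ball_self hε, mem_univ _⟩
    have h2 : ψ 0 = p₀ := by
      rw [hψe, hκ]
      simp only [Prod.snd_zero, Prod.fst_zero, OpenPartialHomeomorph.univBall_apply_zero]
      exact hΨ0
    rw [← h2]
    exact ψ.map_source h1
  · intro x hx
    rw [← ψ.right_inv hx, hψe]
    exact hrS (hΨS _ (hκU _ (ψ.map_target hx)))
  · have h1 : (ψ : ℝ × F → E) = Ψ ∘ κ := funext hψe
    rw [h1]
    exact hΨ.comp hκc.contDiffOn hκU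
  · have h1 : ψ.target = e.target ∩ e.symm ⁻¹' κ.target := κ.trans_target e
    rw [h1]
    exact hκsymm.comp (hesymm.mono inter_subset_left) fun x hx ↦ hx.2
  · have hι : HasDerivAt (fun s : ℝ ↦ κ (s, z.2)) ((1 : ℝ), (0 : F)) z.1 :=
      (hasDerivAt_id z.1).prodMk
        (hasDerivAt_const z.1 (OpenPartialHomeomorph.univBall (0 : F) ε z.2))
    have hι' : HasDerivAt (fun s : ℝ ↦ (s, z.2)) ((1 : ℝ), (0 : F)) z.1 :=
      (hasDerivAt_id z.1).prodMk (hasDerivAt_const z.1 z.2)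
    have h1 : HasDerivAt (fun s : ℝ ↦ κ (s, z.2)) (fderiv ℝ κ z (1, 0)) z.1 :=
      HasFDerivAt.comp_hasDerivAt (f := fun s : ℝ ↦ (s, z.2)) (l := κ) z.1 (hκd z) hι'
    rw [hψd z hz, h1.unique hι, hψe, hΨρ _ (hκU z hz)]
  · rw [hψd z hz, hψe, hΨA _ (hκU z hz), hκ1]

end Splitting

/-! ### Parametrizations and pull-back of vector fields -/

section Parametrization

open Set VectorField

theorem mdifferentiableAt_vectorSpace_iff_differentiableAt {V : Type*} [NormedAddCommGroup V]
    [NormedSpace ℝ V] {X : Π p : V, TangentSpace 𝓘(ℝ, V) p} {p : V} :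
    MDiffAt (T% X) p ↔ DifferentiableAt ℝ (X : V → V) p := by
  refine ⟨fun h ↦ ?_, fun h ↦ ?_⟩
  · exact MDifferentiableAt.differentiableAt <|
      ((contMDiff_snd_tangentBundle_modelSpace V 𝓘(ℝ, V)).contMDiffAt.mdifferentiableAt
        one_ne_zero).comp p h
  · apply (mdifferentiableAt_totalSpace ..).2
    refine ⟨mdifferentiableAt_id, ?_⟩
    convert! h.mdifferentiableAt with y
    simp

variable {V : Type*} [NormedAddCommGroup V] [NormedSpace ℝ V]
  {E : Type*} [NormedAddCommGroup E] [NormedSpace ℝ E]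
  {M : Type*} [TopologicalSpace M] [ChartedSpace E M]

/-- A smooth parametrization of an open subset of the manifold `M` by an open subset of a vector
space: a homeomorphism between them that is smooth in both directions. -/
structure IsParametrization (φ : OpenPartialHomeomorph V M) : Prop where
  contMDiffOn : ContMDiffOn 𝓘(ℝ, V) 𝓘(ℝ, E) ∞ φ φ.source
  contMDiffOn_symm : ContMDiffOn 𝓘(ℝ, E) 𝓘(ℝ, V) ∞ φ.symm φ.target

/-- The pull-back of a vector field by a parametrization, as a map of vector spaces: its
value at `p` is the preimage of `Y (φ p)` under the derivative of `φ` (or `0` if this derivative is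
not invertible). -/
noncomputable def pullbackField (φ : V → M) (Y : Π x : M, TangentSpace 𝓘(ℝ, E) x) (p : V) : V :=
  mpullback 𝓘(ℝ, V) 𝓘(ℝ, E) φ Y p

/-- The pull-back of a metric by a parametrization, as a field of bilinear forms on a vector
space. -/
noncomputable def PseudoRiemannianMetric.pullbackForm [IsManifold 𝓘(ℝ, E) ∞ M]
    (g : PseudoRiemannianMetric E M) (φ : V → M) (p : V) : V →L[ℝ] V →L[ℝ] ℝ :=
  let B : E →L[ℝ] E →L[ℝ] ℝ := g.form (φ p)
  let D : V →L[ℝ] E := mfderiv 𝓘(ℝ, V) 𝓘(ℝ, E) φ p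
  B.bilinearComp D D

namespace IsParametrization

variable {φ : OpenPartialHomeomorph V M}

theorem contMDiffAt (hφ : IsParametrization (E := E) φ) {p : V} (hp : p ∈ φ.source) :
    ContMDiffAt 𝓘(ℝ, V) 𝓘(ℝ, E) ∞ φ p :=
  hφ.contMDiffOn.contMDiffAt (φ.open_source.mem_nhds hp)

theorem mdifferentiableAt (hφ : IsParametrization (E := E) φ) {p : V} (hp : p ∈ φ.source) :
    MDifferentiableAt 𝓘(ℝ, V) 𝓘(ℝ, E) φ p :=
  (hφ.contMDiffAt hp).mdifferentiableAt (by simp)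

theorem contMDiffAt_symm (hφ : IsParametrization (E := E) φ) {x : M} (hx : x ∈ φ.target) :
    ContMDiffAt 𝓘(ℝ, E) 𝓘(ℝ, V) ∞ φ.symm x :=
  hφ.contMDiffOn_symm.contMDiffAt (φ.open_target.mem_nhds hx)

theorem mDifferentiable (hφ : IsParametrization (E := E) φ) :
    φ.MDifferentiable 𝓘(ℝ, V) 𝓘(ℝ, E) :=
  ⟨hφ.contMDiffOn.mdifferentiableOn (by simp), hφ.contMDiffOn_symm.mdifferentiableOn (by simp)⟩

theorem isInvertible_mfderiv (hφ : IsParametrization (E := E) φ) {p : V} (hp : p ∈ φ.source) :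
    (mfderiv 𝓘(ℝ, V) 𝓘(ℝ, E) φ p).IsInvertible :=
  ⟨hφ.mDifferentiable.mfderiv hp, rfl⟩

theorem isInvertible_mfderiv_symm (hφ : IsParametrization (E := E) φ) {x : M}
    (hx : x ∈ φ.target) : (mfderiv 𝓘(ℝ, E) 𝓘(ℝ, V) φ.symm x).IsInvertible :=
  ⟨hφ.mDifferentiable.symm.mfderiv hx, rfl⟩

theorem mfderiv_pullbackField (hφ : IsParametrization (E := E) φ) {p : V} (hp : p ∈ φ.source)
    (Y : Π x : M, TangentSpace 𝓘(ℝ, E) x) :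
    mfderiv 𝓘(ℝ, V) 𝓘(ℝ, E) φ p (pullbackField φ Y p : V) = Y (φ p) := by
  have h : (mfderiv 𝓘(ℝ, V) 𝓘(ℝ, E) φ p).inverse = (hφ.mDifferentiable.mfderiv hp).symm :=
    ContinuousLinearMap.inverse_equiv (hφ.mDifferentiable.mfderiv hp)
  have h2 : (pullbackField φ Y p : V) = (hφ.mDifferentiable.mfderiv hp).symm (Y (φ p)) :=
    congr($h (Y (φ p)))
  exact (congrArg _ h2).trans ((hφ.mDifferentiable.mfderiv hp).apply_symm_apply (Y (φ p)))

/-- Pulling back by the inverse of `φ` is pushing forward by `φ`. -/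
theorem mpullback_symm_apply (hφ : IsParametrization (E := E) φ) {p : V} (hp : p ∈ φ.source)
    (w : Π p : V, TangentSpace 𝓘(ℝ, V) p) :
    mpullback 𝓘(ℝ, E) 𝓘(ℝ, V) φ.symm w (φ p) = mfderiv 𝓘(ℝ, V) 𝓘(ℝ, E) φ p (w p) := by
  have hx := φ.map_source hp
  have h : (mfderiv 𝓘(ℝ, E) 𝓘(ℝ, V) φ.symm (φ p)).inverse =
      (hφ.mDifferentiable.symm.mfderiv hx).symm :=
    ContinuousLinearMap.inverse_equiv (hφ.mDifferentiable.symm.mfderiv hx)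
  have h1 : mpullback 𝓘(ℝ, E) 𝓘(ℝ, V) φ.symm w (φ p) =
      (hφ.mDifferentiable.symm.mfderiv hx).symm (w (φ.symm (φ p))) :=
    congr($h (w (φ.symm (φ p))))
  have h2 := hφ.mDifferentiable.symm_comp_deriv hp
  have h3 : (w (φ.symm (φ p)) : V) = w p := by rw [φ.left_inv hp]
  have h4 : (hφ.mDifferentiable.symm.mfderiv hx) (mfderiv 𝓘(ℝ, V) 𝓘(ℝ, E) φ p (w p)) =
    w (φ.symm (φ p)) := (congr($h2 (w p)) : _).trans h3.symm
  rw [h1, ← h4]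
  exact (hφ.mDifferentiable.symm.mfderiv hx).symm_apply_apply _

theorem pullbackField_mpullback_symm (hφ : IsParametrization (E := E) φ) {p : V}
    (hp : p ∈ φ.source) (w : Π p : V, TangentSpace 𝓘(ℝ, V) p) :
    pullbackField φ (mpullback 𝓘(ℝ, E) 𝓘(ℝ, V) φ.symm w) p = w p :=
  hφ.mDifferentiable.mfderiv_injective hp
    ((hφ.mfderiv_pullbackField hp _).trans (hφ.mpullback_symm_apply hp w))

theorem pullbackField_mpullback_symm_const (hφ : IsParametrization (E := E) φ) {p : V}
    (hp : p ∈ φ.source) (u : V) :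
    pullbackField φ (mpullback 𝓘(ℝ, E) 𝓘(ℝ, V) φ.symm fun _ ↦ (u : V)) =ᶠ[𝓝 p] fun _ ↦ u := by
  filter_upwards [φ.open_source.mem_nhds hp] with q hq
  exact hφ.pullbackField_mpullback_symm hq fun _ ↦ u

theorem mvfderiv_apply (hφ : IsParametrization (E := E) φ) {p : V} (hp : p ∈ φ.source) {f : M → ℝ}
    (hf : MDiffAt f (φ p)) (u : TangentSpace 𝓘(ℝ, V) p) :
    mvfderiv 𝓘(ℝ, E) f (φ p) (mfderiv 𝓘(ℝ, V) 𝓘(ℝ, E) φ p u) = fderiv ℝ (f ∘ φ) p u := by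
  rw [← mvfderiv_comp_apply p hf (hφ.mdifferentiableAt hp)]
  exact congr($(mfderiv_eq_fderiv (f := f ∘ φ) (x := p)) u)

variable [IsManifold 𝓘(ℝ, E) ∞ M]

theorem contMDiffAt_mpullback_symm [CompleteSpace V] [CompleteSpace E]
    (hφ : IsParametrization (E := E) φ) {p : V} (hp : p ∈ φ.source)
    {w : Π p : V, TangentSpace 𝓘(ℝ, V) p} (hw : ContDiffAt ℝ ∞ (w : V → V) p) :
    CMDiffAt ∞ (T% (mpullback 𝓘(ℝ, E) 𝓘(ℝ, V) φ.symm w)) (φ p) := by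
  have hx := φ.map_source hp
  have : IsManifold 𝓘(ℝ, E) 1 M := IsManifold.of_le (n := ∞) (by simp)
  refine ContMDiffAt.mpullback_vectorField_preimage (n := ∞) ?_ (hφ.contMDiffAt_symm hx)
    (hφ.isInvertible_mfderiv_symm hx) (by simp)
  rw [φ.left_inv hp]
  exact contMDiffAt_vectorSpace_iff_contDiffAt.2 hw

theorem mdifferentiableAt_mpullback_symm [CompleteSpace V] [CompleteSpace E]
    (hφ : IsParametrization (E := E) φ) {p : V} (hp : p ∈ φ.source)
    {w : Π p : V, TangentSpace 𝓘(ℝ, V) p} (hw : DifferentiableAt ℝ (w : V → V) p) :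
    MDiffAt (T% (mpullback 𝓘(ℝ, E) 𝓘(ℝ, V) φ.symm w)) (φ p) := by
  have hx := φ.map_source hp
  have : IsManifold 𝓘(ℝ, E) 1 M := IsManifold.of_le (n := ∞) (by simp)
  refine MDifferentiableAt.mpullback_vectorField (n := ∞) ?_ (hφ.contMDiffAt_symm hx)
    (hφ.isInvertible_mfderiv_symm hx) two_le_infty
  rw [φ.left_inv hp]
  exact mdifferentiableAt_vectorSpace_iff_differentiableAt.2 hw

theorem contDiffAt_pullbackField [CompleteSpace V] [CompleteSpace E]
    (hφ : IsParametrization (E := E) φ) {p : V} (hp : p ∈ φ.source)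
    {Y : Π x : M, TangentSpace 𝓘(ℝ, E) x} (hY : CMDiffAt ∞ (T% Y) (φ p)) :
    ContDiffAt ℝ ∞ (pullbackField φ Y) p := by
  have : IsManifold 𝓘(ℝ, E) 1 M := IsManifold.of_le (n := ∞) (by simp)
  exact contMDiffAt_vectorSpace_iff_contDiffAt.1 (ContMDiffAt.mpullback_vectorField_preimage
    (n := ∞) hY (hφ.contMDiffAt hp) (hφ.isInvertible_mfderiv hp) (by simp))

theorem differentiableAt_pullbackField [CompleteSpace V] [CompleteSpace E]
    (hφ : IsParametrization (E := E) φ) {p : V} (hp : p ∈ φ.source)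
    {Y : Π x : M, TangentSpace 𝓘(ℝ, E) x} (hY : MDiffAt (T% Y) (φ p)) :
    DifferentiableAt ℝ (pullbackField φ Y) p := by
  have : IsManifold 𝓘(ℝ, E) 1 M := IsManifold.of_le (n := ∞) (by simp)
  exact mdifferentiableAt_vectorSpace_iff_differentiableAt.1
    (MDifferentiableAt.mpullback_vectorField (n := ∞) hY (hφ.contMDiffAt hp)
      (hφ.isInvertible_mfderiv hp) two_le_infty)

theorem pullbackField_mlieBracket [CompleteSpace V] [CompleteSpace E]
    (hφ : IsParametrization (E := E) φ) {p : V} (hp : p ∈ φ.source)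
    {X Y : Π x : M, TangentSpace 𝓘(ℝ, E) x} (hX : MDiffAt (T% X) (φ p))
    (hY : MDiffAt (T% Y) (φ p)) :
    pullbackField φ (mlieBracket 𝓘(ℝ, E) X Y) p =
      fderiv ℝ (pullbackField φ Y) p (pullbackField φ X p)
        - fderiv ℝ (pullbackField φ X) p (pullbackField φ Y p) := by
  have : IsManifold 𝓘(ℝ, E) (minSmoothness ℝ 2) M := IsManifold.of_le (n := ∞)
    (by simpa using two_le_infty)
  have h := mpullback_mlieBracket (n := ∞) hX hY (hφ.contMDiffAt hp) (by simpa using two_le_infty)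
  refine h.trans ?_
  rw [← mlieBracketWithin_univ, mlieBracketWithin_eq_lieBracketWithin]
  exact congrFun lieBracketWithin_univ p

end IsParametrization

end Parametrization

/-! ### The Levi-Civita connection in a parametrization -/

section LeviCivita

open Set VectorField

variable {V : Type*} [NormedAddCommGroup V] [NormedSpace ℝ V]
  {E : Type*} [NormedAddCommGroup E] [NormedSpace ℝ E]
  {M : Type*} [TopologicalSpace M] [ChartedSpace E M] [IsManifold 𝓘(ℝ, E) ∞ M]

theorem PseudoRiemannianMetric.contMDiffAt_form (g : PseudoRiemannianMetric E M)
    {X Y : Π x : M, TangentSpace 𝓘(ℝ, E) x} {x : M}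
    (hX : CMDiffAt ∞ (T% X) x) (hY : CMDiffAt ∞ (T% Y) x) :
    CMDiffAt ∞ (fun y ↦ g.form y (X y) (Y y)) x := by
  have : ContMDiffAt 𝓘(ℝ, E) (𝓘(ℝ, E).prod 𝓘(ℝ)) ∞ (fun m ↦ Bundle.TotalSpace.mk' ℝ
      (E := Bundle.Trivial M ℝ) m (g.form m (X m) (Y m))) x := by
    apply ContMDiffAt.clm_bundle_apply₂ (F₁ := E) (F₂ := E)
    · exact g.contMDiff.contMDiffAt
    · exact hX
    · exact hY
  simp only [Bundle.contMDiffAt_totalSpace] at this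
  exact this.2

theorem fderiv_bilinear_apply {G : V → V →L[ℝ] V →L[ℝ] ℝ} {A B : V → V} {p : V}
    (hG : DifferentiableAt ℝ G p) (hA : DifferentiableAt ℝ A p) (hB : DifferentiableAt ℝ B p)
    (c : V) :
    fderiv ℝ (fun q ↦ G q (A q) (B q)) p c =
      fderiv ℝ G p c (A p) (B p) + G p (fderiv ℝ A p c) (B p) + G p (A p) (fderiv ℝ B p c) := by
  have h := ((hG.hasFDerivAt.clm_apply hA.hasFDerivAt).clm_apply hB.hasFDerivAt).fderiv
  rw [h]
  simp
  ring

namespace IsParametrization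

variable {φ : OpenPartialHomeomorph V M}

theorem pullbackForm_pullbackField (hφ : IsParametrization (E := E) φ)
    (g : PseudoRiemannianMetric E M) {p : V} (hp : p ∈ φ.source)
    (A B : Π x : M, TangentSpace 𝓘(ℝ, E) x) :
    g.pullbackForm φ p (pullbackField φ A p) (pullbackField φ B p) =
      g.form (φ p) (A (φ p)) (B (φ p)) :=
  congr(g.form (φ p) $(hφ.mfderiv_pullbackField hp A) $(hφ.mfderiv_pullbackField hp B))

variable [FiniteDimensional ℝ V] [CompleteSpace E]

theorem isMetricOn_pullbackForm (hφ : IsParametrization (E := E) φ)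
    (g : PseudoRiemannianMetric E M) : IsMetricOn (g.pullbackForm φ) φ.source where
  isOpen := φ.open_source
  contDiffOn := by
    have : CompleteSpace V := FiniteDimensional.complete ℝ V
    -- The components of the pulled back metric are the products of the push-forwards of constant
    -- fields.
    refine contDiffOn_clm_apply.2 fun u ↦ contDiffOn_clm_apply.2 fun w p hp ↦ ?_
    have hU := hφ.contMDiffAt_mpullback_symm hp (w := fun _ ↦ u) contDiffAt_const
    have hW := hφ.contMDiffAt_mpullback_symm hp (w := fun _ ↦ w) contDiffAt_const
    have h := ((g.contMDiffAt_form hU hW).comp p (hφ.contMDiffAt hp)).contDiffAt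
    refine (h.congr_of_eventuallyEq ?_).contDiffWithinAt
    filter_upwards [φ.open_source.mem_nhds hp] with q hq
    exact congr(g.form (φ q) $((hφ.mpullback_symm_apply hq fun _ ↦ u).symm)
      $((hφ.mpullback_symm_apply hq fun _ ↦ w).symm))
  symm p _ u v := g.symm _ _ _
  nondegenerate p hp u hu := by
    refine hφ.mDifferentiable.mfderiv_injective hp ?_
    refine (g.nondegenerate (φ p) _ fun z ↦ ?_).trans (map_zero _).symm
    obtain ⟨w, rfl⟩ := hφ.mDifferentiable.mfderiv_surjective hp z
    exact hu w

variable {g : PseudoRiemannianMetric E M}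

/-- The product rule for the derivative of `g(A, B)` along `C`, in a parametrization. -/
theorem mvfderiv_form (hφ : IsParametrization (E := E) φ) {p : V} (hp : p ∈ φ.source)
    {A B : Π x : M, TangentSpace 𝓘(ℝ, E) x} (hA : MDiffAt (T% A) (φ p))
    (hB : MDiffAt (T% B) (φ p)) {C : Π x : M, TangentSpace 𝓘(ℝ, E) x} :
    mvfderiv 𝓘(ℝ, E) (fun y ↦ g.form y (A y) (B y)) (φ p) (C (φ p)) =
      fderiv ℝ (g.pullbackForm φ) p (pullbackField φ C p) (pullbackField φ A p)
          (pullbackField φ B p)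
        + g.pullbackForm φ p (fderiv ℝ (pullbackField φ A) p (pullbackField φ C p))
          (pullbackField φ B p)
        + g.pullbackForm φ p (pullbackField φ A p)
          (fderiv ℝ (pullbackField φ B) p (pullbackField φ C p)) := by
  have : CompleteSpace V := FiniteDimensional.complete ℝ V
  have h0 := hφ.mvfderiv_apply hp (g.mdifferentiableAt_form hA hB) (pullbackField φ C p : V)
  have h1 : (fun y ↦ g.form y (A y) (B y)) ∘ φ =ᶠ[𝓝 p]
      fun q ↦ g.pullbackForm φ q (pullbackField φ A q) (pullbackField φ B q) := by
    filter_upwards [φ.open_source.mem_nhds hp] with q hq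
    exact (hφ.pullbackForm_pullbackField g hq A B).symm
  have hc : mfderiv 𝓘(ℝ, V) 𝓘(ℝ, E) φ p (pullbackField φ C p : V) = C (φ p) :=
    hφ.mfderiv_pullbackField hp C
  rw [← hc]
  refine h0.trans ?_
  rw [h1.fderiv_eq]
  exact fderiv_bilinear_apply ((hφ.isMetricOn_pullbackForm g).differentiableAt hp)
    (hφ.differentiableAt_pullbackField hp hA) (hφ.differentiableAt_pullbackField hp hB) _

variable [FiniteDimensional ℝ E] {Γ : V → V →L[ℝ] V →L[ℝ] V}

/-- Naturality of the Levi-Civita connection: in a parametrization it is given by the Christoffel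
symbols of the pulled back metric. Both sides satisfy the Koszul formula, which is tested on fields
`X` and `Z` that are constant in the parametrization. -/
theorem leviCivita_apply (hφ : IsParametrization (E := E) φ)
    (hΓ : IsChristoffel (g.pullbackForm φ) Γ φ.source) {p : V} (hp : p ∈ φ.source)
    {Y : Π x : M, TangentSpace 𝓘(ℝ, E) x} (hY : MDiffAt (T% Y) (φ p))
    (u : V) :
    g.leviCivita Y (φ p) (mfderiv 𝓘(ℝ, V) 𝓘(ℝ, E) φ p u) =
      mfderiv 𝓘(ℝ, V) 𝓘(ℝ, E) φ p
        ((fderiv ℝ (pullbackField φ Y) p u + Γ p u (pullbackField φ Y p) : V)) := by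
  have : CompleteSpace V := FiniteDimensional.complete ℝ V
  have hG := hφ.isMetricOn_pullbackForm g
  refine g.eq_of_form_eq _ fun z ↦ ?_
  obtain ⟨w, rfl⟩ : ∃ w : V, mfderiv 𝓘(ℝ, V) 𝓘(ℝ, E) φ p w = z :=
    hφ.mDifferentiable.mfderiv_surjective hp z
  set X := mpullback 𝓘(ℝ, E) 𝓘(ℝ, V) φ.symm fun _ ↦ u with hX_def
  set Z := mpullback 𝓘(ℝ, E) 𝓘(ℝ, V) φ.symm fun _ ↦ w with hZ_def
  have hX : MDiffAt (T% X) (φ p) :=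
    hφ.mdifferentiableAt_mpullback_symm hp (differentiableAt_const (u : V))
  have hZ : MDiffAt (T% Z) (φ p) :=
    hφ.mdifferentiableAt_mpullback_symm hp (differentiableAt_const (w : V))
  have hXp : X (φ p) = mfderiv 𝓘(ℝ, V) 𝓘(ℝ, E) φ p u := hφ.mpullback_symm_apply hp _
  have hZp : Z (φ p) = mfderiv 𝓘(ℝ, V) 𝓘(ℝ, E) φ p w := hφ.mpullback_symm_apply hp _
  have hX0 := hφ.pullbackField_mpullback_symm_const hp u
  have hZ0 := hφ.pullbackField_mpullback_symm_const hp w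
  have hX' : fderiv ℝ (pullbackField φ X) p = 0 := by
    rw [hX0.fderiv_eq, fderiv_const_apply]
  have hZ' : fderiv ℝ (pullbackField φ Z) p = 0 := by
    rw [hZ0.fderiv_eq, fderiv_const_apply]
  have hXe : pullbackField φ X p = u := hX0.eq_of_nhds
  have hZe : pullbackField φ Z p = w := hZ0.eq_of_nhds
  have h := g.form_leviCivitaFun hX hY hZ
  have hform (A B : Π x : M, TangentSpace 𝓘(ℝ, E) x) := hφ.pullbackForm_pullbackField g hp A B
  rw [PseudoRiemannianMetric.koszul, hφ.mvfderiv_form hp hY hZ, hφ.mvfderiv_form hp hZ hX,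
    hφ.mvfderiv_form hp hX hY, ← hform, ← hform, ← hform, hφ.pullbackField_mlieBracket hp hX hY,
    hφ.pullbackField_mlieBracket hp hY hZ, hφ.pullbackField_mlieBracket hp hZ hX,
    hX', hZ', hXe, hZe] at h
  rw [← hXp, ← hZp]
  refine h.trans ?_
  rw [hZp]
  have hk := hΓ.koszul p hp u (pullbackField φ Y p) w
  have hR : g.form (φ p) (mfderiv 𝓘(ℝ, V) 𝓘(ℝ, E) φ p
        ((fderiv ℝ (pullbackField φ Y) p u + Γ p u (pullbackField φ Y p) : V)))
      (mfderiv 𝓘(ℝ, V) 𝓘(ℝ, E) φ p w) =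
      g.pullbackForm φ p (fderiv ℝ (pullbackField φ Y) p u + Γ p u (pullbackField φ Y p)) w := rfl
  refine Eq.trans ?_ hR.symm
  have e1 := hG.fderiv_symm hp (pullbackField φ Y p) w u
  have e2 := hG.symm p hp u (fderiv ℝ (pullbackField φ Y) p w)
  simp only [map_add, add_apply, map_sub, map_zero, sub_apply, zero_apply]
  linarith

end IsParametrization

end LeviCivita

/-! ### Curvature and Ricci tensor in a parametrization -/

section Curvature

open Set VectorField

variable {V : Type*} [NormedAddCommGroup V] [NormedSpace ℝ V] [FiniteDimensional ℝ V]
  {E : Type*} [NormedAddCommGroup E] [NormedSpace ℝ E] [FiniteDimensional ℝ E]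
  {M : Type*} [TopologicalSpace M] [ChartedSpace E M] [IsManifold 𝓘(ℝ, E) ∞ M]
  {g : PseudoRiemannianMetric E M} {φ : OpenPartialHomeomorph V M}
  {Γ : V → V →L[ℝ] V →L[ℝ] V}

namespace IsParametrization

theorem pullbackField_leviCivita (hφ : IsParametrization (E := E) φ)
    (hΓ : IsChristoffel (g.pullbackForm φ) Γ φ.source) {p : V} (hp : p ∈ φ.source)
    {Z : Π x : M, TangentSpace 𝓘(ℝ, E) x} (hZ : CMDiffAt ∞ (T% Z) (φ p))
    (Y : Π x : M, TangentSpace 𝓘(ℝ, E) x) :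
    pullbackField φ (fun x ↦ g.leviCivita Z x (Y x)) =ᶠ[𝓝 p]
      fun q ↦ fderiv ℝ (pullbackField φ Z) q (pullbackField φ Y q)
        + Γ q (pullbackField φ Y q) (pullbackField φ Z q) := by
  have : IsManifold 𝓘(ℝ, E) 1 M := IsManifold.of_le (n := ∞) (by simp)
  have h1 : ∀ᶠ x in 𝓝 (φ p), CMDiffAt 1 (T% Z) x :=
    (contMDiffAt_iff_contMDiffAt_nhds (by simp)).1 (hZ.of_le (by simp))
  filter_upwards [φ.open_source.mem_nhds hp, (φ.continuousAt hp).eventually h1] with q hq hZq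
  refine hφ.mDifferentiable.mfderiv_injective hq ?_
  refine (hφ.mfderiv_pullbackField hq _).trans ?_
  refine Eq.trans ?_ (hφ.leviCivita_apply hΓ hq (hZq.mdifferentiableAt one_ne_zero) _)
  exact congrArg (g.leviCivita Z (φ q)) (hφ.mfderiv_pullbackField hq Y).symm

theorem mdifferentiableAt_leviCivita (hφ : IsParametrization (E := E) φ)
    (hΓ : IsChristoffel (g.pullbackForm φ) Γ φ.source) {p : V} (hp : p ∈ φ.source)
    {Y Z : Π x : M, TangentSpace 𝓘(ℝ, E) x} (hY : MDiffAt (T% Y) (φ p))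
    (hZ : CMDiffAt ∞ (T% Z) (φ p)) :
    MDiffAt (T% fun x ↦ g.leviCivita Z x (Y x)) (φ p) := by
  have : CompleteSpace V := FiniteDimensional.complete ℝ V
  have : CompleteSpace E := FiniteDimensional.complete ℝ E
  set F : V → V := fun q ↦ fderiv ℝ (pullbackField φ Z) q (pullbackField φ Y q)
        + Γ q (pullbackField φ Y q) (pullbackField φ Z q) with hF
  have hY' := hφ.differentiableAt_pullbackField hp hY
  have hZ' := hφ.contDiffAt_pullbackField hp hZ
  have hFd : DifferentiableAt ℝ F p :=
    (((hZ'.fderiv_right (m := 1) two_le_infty).differentiableAt one_ne_zero).clm_apply hY').add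
      (((hΓ.differentiableAt (hφ.isMetricOn_pullbackForm g) hp).clm_apply hY').clm_apply
        (hZ'.differentiableAt (by simp)))
  refine (hφ.mdifferentiableAt_mpullback_symm hp hFd).congr_of_eventuallyEq ?_
  rw [← φ.map_nhds_eq hp, Filter.EventuallyEq, Filter.eventually_map]
  filter_upwards [φ.open_source.mem_nhds hp, hφ.pullbackField_leviCivita hΓ hp hZ Y] with q hq hqF
  have h1 := hφ.mfderiv_pullbackField hq fun x ↦ g.leviCivita Z x (Y x)
  have h2 := hφ.mpullback_symm_apply hq F
  have h3 : g.leviCivita Z (φ q) (Y (φ q)) = mpullback 𝓘(ℝ, E) 𝓘(ℝ, V) φ.symm F (φ q) :=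
    h1.symm.trans ((congrArg (mfderiv 𝓘(ℝ, V) 𝓘(ℝ, E) φ q) hqF).trans h2.symm)
  rw [h3]

theorem curvature_apply (hφ : IsParametrization (E := E) φ)
    (hΓ : IsChristoffel (g.pullbackForm φ) Γ φ.source) {p : V} (hp : p ∈ φ.source)
    {X Y Z : Π x : M, TangentSpace 𝓘(ℝ, E) x} (hX : MDiffAt (T% X) (φ p))
    (hY : MDiffAt (T% Y) (φ p)) (hZ : CMDiffAt ∞ (T% Z) (φ p)) :
    g.curvature X Y Z (φ p) = mfderiv 𝓘(ℝ, V) 𝓘(ℝ, E) φ p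
      (curvatureMap Γ p (pullbackField φ Y p) (pullbackField φ Z p) (pullbackField φ X p) : V) := by
  have : CompleteSpace V := FiniteDimensional.complete ℝ V
  have : CompleteSpace E := FiniteDimensional.complete ℝ E
  have key (A B : Π x : M, TangentSpace 𝓘(ℝ, E) x) (hA : MDiffAt (T% A) (φ p)) :
      g.leviCivita A (φ p) (B (φ p)) = mfderiv 𝓘(ℝ, V) 𝓘(ℝ, E) φ p
        (fderiv ℝ (pullbackField φ A) p (pullbackField φ B p)
          + Γ p (pullbackField φ B p) (pullbackField φ A p) : V) :=
    (congrArg (g.leviCivita A (φ p)) (hφ.mfderiv_pullbackField hp B).symm).trans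
      (hφ.leviCivita_apply hΓ hp hA _)
  have hX' := hφ.differentiableAt_pullbackField hp hX
  have hY' := hφ.differentiableAt_pullbackField hp hY
  have hZ' := hφ.contDiffAt_pullbackField hp hZ
  have h1 := key _ X (hφ.mdifferentiableAt_leviCivita hΓ hp hY hZ)
  have h2 := key _ Y (hφ.mdifferentiableAt_leviCivita hΓ hp hX hZ)
  have h3 := key Z (mlieBracket 𝓘(ℝ, E) X Y) (hZ.mdifferentiableAt (by simp))
  have e1 := hφ.pullbackField_leviCivita hΓ hp hZ Y
  have e2 := hφ.pullbackField_leviCivita hΓ hp hZ X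
  rw [e1.fderiv_eq, e1.eq_of_nhds] at h1
  rw [e2.fderiv_eq, e2.eq_of_nhds] at h2
  rw [hφ.pullbackField_mlieBracket hp hX hY] at h3
  rw [PseudoRiemannianMetric.curvature, h1, h2, h3,
    ← covariantDerivative_commutator (hΓ.differentiableAt (hφ.isMetricOn_pullbackForm g) hp) hX' hY'
      (hZ'.of_le two_le_infty)]
  refine Eq.symm ((map_sub (mfderiv 𝓘(ℝ, V) 𝓘(ℝ, E) φ p) _ _).trans ?_)
  exact congrArg (· - _) (map_sub (mfderiv 𝓘(ℝ, V) 𝓘(ℝ, E) φ p) _ _)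

theorem ricci_apply (hφ : IsParametrization (E := E) φ)
    (hΓ : IsChristoffel (g.pullbackForm φ) Γ φ.source) {p : V} (hp : p ∈ φ.source) (v w : V) :
    g.ricci (φ p) (mfderiv 𝓘(ℝ, V) 𝓘(ℝ, E) φ p v) (mfderiv 𝓘(ℝ, V) 𝓘(ℝ, E) φ p w) =
      LinearMap.trace ℝ V (curvatureMap Γ p v w) := by
  let e : V ≃L[ℝ] E := hφ.mDifferentiable.mfderiv hp
  have he (z : TangentSpace 𝓘(ℝ, E) (φ p)) :
      pullbackField φ (FiberBundle.extend E z) p = e.symm z := by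
    refine (ContinuousLinearEquiv.eq_symm_apply e).2 ?_
    refine (hφ.mfderiv_pullbackField hp _).trans ?_
    exact FiberBundle.extend_apply_self ..
  have hm (z : TangentSpace 𝓘(ℝ, E) (φ p)) :
      CMDiffAt ∞ (T% (FiberBundle.extend E z)) (φ p) := FiberBundle.contMDiffAt_extend ..
  rw [← LinearMap.trace_conj' (curvatureMap Γ p v w) e.toLinearEquiv,
    LinearMap.trace_eq_matrix_trace ℝ (Module.finBasis ℝ E), Matrix.trace,
    PseudoRiemannianMetric.ricci]
  refine Finset.sum_congr rfl fun i _ ↦ ?_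
  rw [Matrix.diag_apply, LinearMap.toMatrix_apply, LinearEquiv.conj_apply_apply]
  have h := hφ.curvature_apply hΓ hp ((hm (Module.finBasis ℝ E i : E)).mdifferentiableAt (by simp))
    ((hm (e v : E)).mdifferentiableAt (by simp)) (hm (e w : E))
  have hv := (he (e v : E)).trans (e.symm_apply_apply v)
  have hw := (he (e w : E)).trans (e.symm_apply_apply w)
  refine congrArg (fun z : E ↦ (Module.finBasis ℝ E).repr z i) (h.trans (congrArg e ?_))
  exact congr(curvatureMap Γ p $hv $hw $(he (Module.finBasis ℝ E i : E)))

end IsParametrization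

end Curvature

/-! ### Products with a line -/

section Product

open Set

variable {F : Type*} [NormedAddCommGroup F] [NormedSpace ℝ F]

/-- The Christoffel symbols, on the product of a line with `F`, of the product connection. -/
noncomputable def prodChristoffel (Γ : F → F →L[ℝ] F →L[ℝ] F) (p : ℝ × F) :
    (ℝ × F) →L[ℝ] (ℝ × F) →L[ℝ] ℝ × F :=
  (ContinuousLinearMap.compL ℝ (ℝ × F) F (ℝ × F) (ContinuousLinearMap.inr ℝ ℝ F)).comp
    ((Γ p.2).bilinearComp (ContinuousLinearMap.snd ℝ ℝ F) (ContinuousLinearMap.snd ℝ ℝ F))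

theorem prodChristoffel_apply (Γ : F → F →L[ℝ] F →L[ℝ] F) (p u v : ℝ × F) :
    prodChristoffel Γ p u v = (0, Γ p.2 u.2 v.2) := rfl

theorem fderiv_apply_apply_const {X : Type*} [NormedAddCommGroup X] [NormedSpace ℝ X]
    {A : F → F →L[ℝ] F →L[ℝ] X} {q : F} (hA : DifferentiableAt ℝ A q) (a b c : F) :
    fderiv ℝ (fun x ↦ A x b c) q a = fderiv ℝ A q a b c := by
  rw [fderiv_clm_apply_const (hA.clm_apply (differentiableAt_const b)), fderiv_clm_apply_const hA]

theorem hasFDerivAt_comp_snd_apply {X : Type*} [NormedAddCommGroup X] [NormedSpace ℝ X]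
    {A : F → F →L[ℝ] F →L[ℝ] X} {p : ℝ × F} (hA : DifferentiableAt ℝ A p.2) (b c : F) :
    HasFDerivAt (fun q : ℝ × F ↦ A q.2 b c)
      ((fderiv ℝ (fun x ↦ A x b c) p.2).comp (ContinuousLinearMap.snd ℝ ℝ F)) p :=
  HasFDerivAt.comp (g := fun x ↦ A x b c) p ((hA.clm_apply (differentiableAt_const b)).clm_apply
    (differentiableAt_const c)).hasFDerivAt hasFDerivAt_snd

variable [FiniteDimensional ℝ F] {Γ : F → F →L[ℝ] F →L[ℝ] F}

theorem contDiff_prodChristoffel (hΓ : ContDiff ℝ ∞ Γ) : ContDiff ℝ ∞ (prodChristoffel Γ) := by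
  refine contDiff_clm_apply_iff.2 fun u ↦ contDiff_clm_apply_iff.2 fun v ↦ ?_
  simp only [prodChristoffel_apply]
  exact contDiff_const.prodMk
    (((hΓ.comp contDiff_snd).clm_apply contDiff_const).clm_apply contDiff_const)

theorem isChristoffel_prodChristoffel {H : F → F →L[ℝ] F →L[ℝ] ℝ} (hH : IsMetricOn H univ)
    (hΓ : IsChristoffel H Γ univ) {G : ℝ × F → (ℝ × F) →L[ℝ] (ℝ × F) →L[ℝ] ℝ} {S : Set (ℝ × F)}
    (hG : IsMetricOn G S) (hGH : ∀ p ∈ S, ∀ v w, G p v w = -(v.1 * w.1) + H p.2 v.2 w.2) :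
    IsChristoffel G (prodChristoffel Γ) S where
  contDiffOn := (contDiff_prodChristoffel (contDiffOn_univ.1 hΓ.contDiffOn)).contDiffOn
  koszul p hp u v w := by
    have hd (a b c : ℝ × F) : fderiv ℝ G p a b c = fderiv ℝ H p.2 a.2 b.2 c.2 := by
      have h1 : (fun q ↦ G q b c) =ᶠ[𝓝 p] fun q ↦ -(b.1 * c.1) + H q.2 b.2 c.2 := by
        filter_upwards [hG.isOpen.mem_nhds hp] with q hq using hGH q hq b c
      have hGd := hG.differentiableAt hp
      have hHd := hH.differentiableAt (mem_univ p.2)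
      rw [← fderiv_clm_apply_const hGd,
        ← fderiv_clm_apply_const (hGd.clm_apply (differentiableAt_const b)), h1.fderiv_eq,
        fderiv_const_add, (hasFDerivAt_comp_snd_apply hHd b.2 c.2).fderiv,
        ContinuousLinearMap.comp_apply, ContinuousLinearMap.coe_snd', fderiv_apply_apply_const hHd]
    rw [hGH p hp, prodChristoffel_apply, hd, hd, hd, ← hΓ.koszul p.2 (mem_univ _)]
    simp

theorem curvatureMap_prodChristoffel (hΓ : ContDiff ℝ ∞ Γ) (p : ℝ × F) (v w : ℝ × F) :
    curvatureMap (prodChristoffel Γ) p v w =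
      LinearMap.inr ℝ ℝ F ∘ₗ curvatureMap Γ p.2 v.2 w.2 ∘ₗ LinearMap.snd ℝ ℝ F := by
  have hd : DifferentiableAt ℝ (prodChristoffel Γ) p :=
    (contDiff_prodChristoffel hΓ).differentiable (by simp) p
  have hΓd : DifferentiableAt ℝ Γ p.2 := hΓ.differentiable (by simp) p.2
  have h (a b c : ℝ × F) :
      fderiv ℝ (prodChristoffel Γ) p a b c = (0, fderiv ℝ Γ p.2 a.2 b.2 c.2) := by
    have h2 := (hasFDerivAt_const (0 : ℝ) p).prodMk (hasFDerivAt_comp_snd_apply hΓd b.2 c.2)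
    rw [← fderiv_clm_apply_const hd,
      ← fderiv_clm_apply_const (hd.clm_apply (differentiableAt_const b))]
    refine (congr($(h2.fderiv) a)).trans ?_
    rw [ContinuousLinearMap.prod_apply, ContinuousLinearMap.comp_apply,
      ContinuousLinearMap.coe_snd', fderiv_apply_apply_const hΓd, zero_apply]
  ext u <;> simp [curvatureMap_apply, h, prodChristoffel_apply]

theorem trace_curvatureMap_prodChristoffel (hΓ : ContDiff ℝ ∞ Γ) (p : ℝ × F)
    (v w : ℝ × F) : LinearMap.trace ℝ (ℝ × F) (curvatureMap (prodChristoffel Γ) p v w) =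
      LinearMap.trace ℝ F (curvatureMap Γ p.2 v.2 w.2) := by
  rw [curvatureMap_prodChristoffel hΓ, LinearMap.trace_comp_comm', LinearMap.comp_assoc]
  rfl

end Product

/-! ### Metrics on a vector space as a manifold -/

section Fibre

open Set Metric

variable {F : Type*} [NormedAddCommGroup F] [NormedSpace ℝ F]

/-- A metric on a whole vector space, as a metric on this vector space seen as a manifold. -/
noncomputable def IsMetricOn.toPseudoRiemannianMetric {H : F → F →L[ℝ] F →L[ℝ] ℝ}
    (hH : IsMetricOn H univ) : PseudoRiemannianMetric F F where
  form := H
  symm q := hH.symm q (mem_univ q)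
  nondegenerate q := hH.nondegenerate q (mem_univ q)
  contMDiff := by
    intro q
    let s (x : F) : TangentSpace 𝓘(ℝ, F) x →L[ℝ] TangentSpace 𝓘(ℝ, F) x →L[ℝ] ℝ := H x
    refine (Bundle.contMDiffAt_section (s := s) q).2 ?_
    convert! (contDiffOn_univ.1 hH.contDiffOn).contDiffAt.contMDiffAt (x := q) using 2 with x
    ext v w
    have h1 := hom_trivializationAt_apply (σ := RingHom.id ℝ) (F₁ := F)
      (E₁ := (TangentSpace 𝓘(ℝ, F) : F → Type _)) (F₂ := F →L[ℝ] ℝ)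
      (E₂ := fun x ↦ TangentSpace 𝓘(ℝ, F) x →L[ℝ] ℝ) q ⟨x, s x⟩
    refine (congr(($h1).2 v w)).trans ?_
    dsimp only
    -- The trivializations of the tangent bundle of a vector space are the identity.
    have hx : x ∈ (trivializationAt F (TangentSpace 𝓘(ℝ, F)) q).baseSet := by
      rw [TangentBundle.trivializationAt_baseSet, chartAt_self_eq]
      exact mem_univ x
    have hsymm (u : F) : (trivializationAt F (TangentSpace 𝓘(ℝ, F)) q).symm x u = u :=
      (Bundle.Trivialization.symmL_apply (R := ℝ) _ hx u).symm.trans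
        (congrArg (fun A : F →L[ℝ] F ↦ A u) (TangentBundle.symmL_model_space q x))
    refine (inCoordinates_apply_eq₂ (F₁ := F) (F₂ := F) (F₃ := ℝ) hx hx (by simp)).trans ?_
    simp only [hsymm]
    exact congr($(Bundle.Trivial.linearMapAt_trivialization ℝ F ℝ x) (H x v w))

variable [FiniteDimensional ℝ F]

/-- The identity is a parametrization of a vector space by itself, which computes the Ricci
tensor. -/
theorem IsMetricOn.ricci_toPseudoRiemannianMetric {H : F → F →L[ℝ] F →L[ℝ] ℝ}
    (hH : IsMetricOn H univ) {Γ : F → F →L[ℝ] F →L[ℝ] F} (hΓ : IsChristoffel H Γ univ)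
    (q v w : F) :
    hH.toPseudoRiemannianMetric.ricci q v w = LinearMap.trace ℝ F (curvatureMap Γ q v w) := by
  have hid : IsParametrization (E := F) (OpenPartialHomeomorph.refl F) :=
    ⟨contMDiffOn_id, contMDiffOn_id⟩
  have hD (q : F) : mfderiv 𝓘(ℝ, F) 𝓘(ℝ, F) (OpenPartialHomeomorph.refl F) q =
      ContinuousLinearMap.id ℝ F := mfderiv_id
  have hf : hH.toPseudoRiemannianMetric.pullbackForm (OpenPartialHomeomorph.refl F) = H := by
    ext q v w
    exact congr(H q ($(hD q) v) ($(hD q) w))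
  have h := hid.ricci_apply (g := hH.toPseudoRiemannianMetric) (Γ := Γ) (by rw [hf]; exact hΓ)
    (mem_univ q) v w
  rw [← h]
  exact congr(hH.toPseudoRiemannianMetric.ricci q ($((hD q).symm) v) ($((hD q).symm) w))

end Fibre

/-! ### Perfect fluids with a concircular velocity field -/

section Main

open Set Metric

/-- The orthogonal complement of any timelike vector of a Lorentzian form is positive definite. -/
theorem pos_of_orthogonal_timelike {V : Type*} [NormedAddCommGroup V] [NormedSpace ℝ V]
    {B : V →L[ℝ] V →L[ℝ] ℝ} (hsymm : ∀ a b, B a b = B b a) {v r u : V}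
    (hv : ∀ w, B v w = 0 → w ≠ 0 → 0 < B w w) (hr : B r r < 0) (hru : B r u = 0) (hu : u ≠ 0) :
    0 < B u u := by
  have hvr : B v r ≠ 0 := fun h ↦ absurd (hv r h (by rintro rfl; simp at hr)) (not_lt.2 hr.le)
  -- A combination of `r` and `u` that is orthogonal to `v`.
  have hw := hv (B v u • r - B v r • u) (by simp; ring)
  have hur : B u r = 0 := (hsymm u r).trans hru
  have hw0 : B v u • r - B v r • u ≠ 0 := by
    intro h
    have h1 : B r (B v u • r - B v r • u) = 0 := by rw [h, map_zero]
    have h2 : B v u = 0 := by simpa [hru, hr.ne] using h1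
    rw [h2, zero_smul, zero_sub, neg_eq_zero] at h
    exact (smul_ne_zero hvr hu) h
  have h := hw hw0
  simp [hru, hur] at h
  have h3 : 0 < B v r ^ 2 := by positivity
  by_contra! hn
  nlinarith [mul_nonneg (sq_nonneg (B v u)) (neg_nonneg.2 hr.le),
    mul_nonneg h3.le (neg_nonneg.2 hn)]

namespace PseudoRiemannianMetric

variable {E : Type*} [NormedAddCommGroup E] [NormedSpace ℝ E] [FiniteDimensional ℝ E]
  {M : Type*} [TopologicalSpace M] [ChartedSpace E M] [IsManifold 𝓘(ℝ, E) ∞ M]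
  {g : PseudoRiemannianMetric E M}

/-- A concircular vector field of constant nonzero square is parallel: differentiating
`g(ρ, ρ)` along `ρ` gives `0 = 2 μ g(ρ, ρ)`. -/
theorem IsConcircular.leviCivita_eq_zero {ρ : Π x : M, TangentSpace 𝓘(ℝ, E) x}
    (hρ : g.IsConcircular ρ) (hs : CMDiff ∞ (T% ρ)) (hunit : ∀ x, g.form x (ρ x) (ρ x) = -1)
    (x : M) (u : TangentSpace 𝓘(ℝ, E) x) : g.leviCivita ρ x u = 0 := by
  obtain ⟨μ, -, hμ⟩ := hρ
  have hd : MDiffAt (T% ρ) x := (hs x).mdifferentiableAt (by simp)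
  have h := g.leviCivita_metric hd hd hd
  have hc : (fun y ↦ g.form y (ρ y) (ρ y)) = fun _ ↦ (-1 : ℝ) := funext hunit
  rw [hc, hμ, map_smul, smul_apply, map_smul, hunit] at h
  have h0 : mvfderiv 𝓘(ℝ, E) (fun _ : M ↦ (-1 : ℝ)) x (ρ x) = 0 := by
    rw [mvfderiv_const]; rfl
  rw [h0] at h
  have : μ x = 0 := by simp at h; linarith
  rw [hμ, this, zero_smul]

end PseudoRiemannianMetric

/-- If the metric is `-dt² + H` in a parametrization by `J × F` with `F` of dimension three, and the
Ricci tensor is proportional to `H` along the fibre `0 × F`, then `H` is an Einstein metric. -/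
theorem IsMetricOn.isEinstein_of_isParametrization {F : Type*} [NormedAddCommGroup F]
    [NormedSpace ℝ F] [FiniteDimensional ℝ F] (hdim : Module.finrank ℝ F = 3)
    {E : Type*} [NormedAddCommGroup E] [NormedSpace ℝ E] [FiniteDimensional ℝ E]
    {M : Type*} [TopologicalSpace M] [ChartedSpace E M] [IsManifold 𝓘(ℝ, E) ∞ M]
    {g : PseudoRiemannianMetric E M} {φ : OpenPartialHomeomorph (ℝ × F) M}
    (hφ : IsParametrization (E := E) φ) (hsource : ∀ q, ((0 : ℝ), q) ∈ φ.source)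
    {H : F → F →L[ℝ] F →L[ℝ] ℝ} (hH : IsMetricOn H univ)
    (hpos : ∀ q v, v ≠ 0 → 0 < H q v v)
    (hgH : ∀ p ∈ φ.source, ∀ v w, g.pullbackForm φ p v w = -(v.1 * w.1) + H p.2 v.2 w.2)
    {α : M → ℝ} (hα : ContMDiff 𝓘(ℝ, E) 𝓘(ℝ) ∞ α)
    (hricci : ∀ q v w, g.ricci (φ (0, q)) (mfderiv 𝓘(ℝ, ℝ × F) 𝓘(ℝ, E) φ (0, q) ((0, v) : ℝ × F))
      (mfderiv 𝓘(ℝ, ℝ × F) 𝓘(ℝ, E) φ (0, q) ((0, w) : ℝ × F)) = α (φ (0, q)) * H q v w) :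
    hH.toPseudoRiemannianMetric.IsEinstein := by
  have : CompleteSpace E := FiniteDimensional.complete ℝ E
  obtain ⟨Γ, hΓ⟩ := hH.exists_isChristoffel
  have hP := isChristoffel_prodChristoffel hH hΓ (hφ.isMetricOn_pullbackForm g) hgH
  have htr (q v w) : LinearMap.trace ℝ F (curvatureMap Γ q v w) = α (φ (0, q)) * H q v w := by
    rw [← hricci, hφ.ricci_apply hP (hsource q),
      trace_curvatureMap_prodChristoffel (contDiffOn_univ.1 hΓ.contDiffOn)]
  have hd : Differentiable ℝ fun q ↦ α (φ (0, q)) := by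
    intro q
    have h1 := (((hα (φ (0, q))).comp (0, q) (hφ.contMDiffAt (hsource q))).contDiffAt
      ).differentiableAt (by simp)
    exact DifferentiableAt.comp (g := α ∘ φ) (f := fun q : F ↦ ((0 : ℝ), q)) q h1 (by fun_prop)
  have hc (q : F) : α (φ (0, q)) = α (φ (0, 0)) :=
    is_const_of_fderiv_eq_zero hd (fun q ↦ hΓ.fderiv_ricci_factor_eq_zero hdim hH
      (fun q _ ↦ hpos q) (fun q _ ↦ hd q) (fun q _ ↦ htr q) (mem_univ q)) q 0
  refine ⟨α (φ (0, 0)), fun q v w ↦ ?_⟩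
  have h := hH.ricci_toPseudoRiemannianMetric hΓ q v w
  refine h.trans ((htr q v w).trans ?_)
  rw [hc]
  rfl

/-- The Lorentzian signature in a parametrization. -/
theorem IsParametrization.exists_timelike {V : Type*} [NormedAddCommGroup V] [NormedSpace ℝ V]
    {E : Type*} [NormedAddCommGroup E] [NormedSpace ℝ E]
    {M : Type*} [TopologicalSpace M] [ChartedSpace E M] [IsManifold 𝓘(ℝ, E) ∞ M]
    {g : PseudoRiemannianMetric E M} {φ : OpenPartialHomeomorph V M}
    (hφ : IsParametrization (E := E) φ) (hg : g.IsLorentzian) {p : V} (hp : p ∈ φ.source) :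
    ∃ v, ∀ w, g.pullbackForm φ p v w = 0 → w ≠ 0 → 0 < g.pullbackForm φ p w w := by
  obtain ⟨v', -, hv'⟩ := hg (φ p)
  obtain ⟨v, rfl⟩ : ∃ v : V, mfderiv 𝓘(ℝ, V) 𝓘(ℝ, E) φ p v = v' :=
    hφ.mDifferentiable.mfderiv_surjective hp v'
  refine ⟨v, fun w hw hw0 ↦ hv' (mfderiv 𝓘(ℝ, V) 𝓘(ℝ, E) φ p w) hw fun h ↦ hw0 ?_⟩
  exact hφ.mDifferentiable.mfderiv_injective hp (h.trans (map_zero _).symm)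

/-- The product of two vector spaces, as a product of manifolds, has the same smooth maps as the
vector space that is their product. -/
theorem contMDiffOn_prod_self_iff {V F : Type*} [NormedAddCommGroup V] [NormedSpace ℝ V]
    [NormedAddCommGroup F] [NormedSpace ℝ F]
    {E : Type*} [NormedAddCommGroup E] [NormedSpace ℝ E]
    {M : Type*} [TopologicalSpace M] [ChartedSpace E M] {φ : V × F → M} {s : Set (V × F)} :
    ContMDiffOn (𝓘(ℝ, V).prod 𝓘(ℝ, F)) 𝓘(ℝ, E) ∞ φ s ↔ ContMDiffOn 𝓘(ℝ, V × F) 𝓘(ℝ, E) ∞ φ s := by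
  rw [modelWithCornersSelf_prod, ← chartedSpaceSelf_prod]

theorem contMDiffOn_to_prod_self_iff {V F : Type*} [NormedAddCommGroup V] [NormedSpace ℝ V]
    [NormedAddCommGroup F] [NormedSpace ℝ F]
    {E : Type*} [NormedAddCommGroup E] [NormedSpace ℝ E]
    {M : Type*} [TopologicalSpace M] [ChartedSpace E M] {φ : M → V × F} {s : Set M} :
    ContMDiffOn 𝓘(ℝ, E) (𝓘(ℝ, V).prod 𝓘(ℝ, F)) ∞ φ s ↔ ContMDiffOn 𝓘(ℝ, E) 𝓘(ℝ, V × F) ∞ φ s := by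
  rw [modelWithCornersSelf_prod, ← chartedSpaceSelf_prod]

theorem mfderiv_prod_self_apply {V F : Type*} [NormedAddCommGroup V] [NormedSpace ℝ V]
    [NormedAddCommGroup F] [NormedSpace ℝ F]
    {E : Type*} [NormedAddCommGroup E] [NormedSpace ℝ E]
    {M : Type*} [TopologicalSpace M] [ChartedSpace E M] (φ : V × F → M) (p v : V × F) :
    mfderiv (𝓘(ℝ, V).prod 𝓘(ℝ, F)) 𝓘(ℝ, E) φ p v = mfderiv 𝓘(ℝ, V × F) 𝓘(ℝ, E) φ p v := by
  rw [modelWithCornersSelf_prod, ← chartedSpaceSelf_prod]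

/-- A parametrization of an open subset of a Lorentzian manifold by `J × F` in which the metric is
`-dt² + H`, with `∂ₜ` the velocity of a perfect fluid, presents this open subset as a product with
an Einstein fibre. -/
theorem IsParametrization.isGRWWithEinsteinFibreOn {F : Type} [NormedAddCommGroup F]
    [NormedSpace ℝ F] [FiniteDimensional ℝ F] (hdim : Module.finrank ℝ F = 3)
    {E : Type*} [NormedAddCommGroup E] [NormedSpace ℝ E] [FiniteDimensional ℝ E]
    {M : Type*} [TopologicalSpace M] [ChartedSpace E M] [IsManifold 𝓘(ℝ, E) ∞ M]
    {g : PseudoRiemannianMetric E M} {ρ : Π x : M, TangentSpace 𝓘(ℝ, E) x}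
    (hfluid : g.IsPerfectFluid ρ) {φ : OpenPartialHomeomorph (ℝ × F) M}
    (hφ : IsParametrization (E := E) φ) {ε : ℝ} (hε : 0 < ε)
    (hsource : φ.source = ball 0 ε ×ˢ univ)
    (hφρ : ∀ p ∈ φ.source, mfderiv 𝓘(ℝ, ℝ × F) 𝓘(ℝ, E) φ p ((1, 0) : ℝ × F) = ρ (φ p))
    {H : F → F →L[ℝ] F →L[ℝ] ℝ} (hHs : ContDiff ℝ ∞ H)
    (hgH : ∀ p ∈ φ.source, ∀ v w, g.pullbackForm φ p v w = -(v.1 * w.1) + H p.2 v.2 w.2) :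
    g.IsGRWWithEinsteinFibreOn F φ.target := by
  have h0 (q : F) : ((0 : ℝ), q) ∈ φ.source := by simp [hsource, hε]
  have hform (q : F) (v w : ℝ × F) := hgH (0, q) (h0 q) v w
  have hpos (q v : F) (hv : v ≠ 0) : 0 < H q v v := by
    obtain ⟨z, hz⟩ := hφ.exists_timelike hfluid.lorentzian (h0 q)
    have h := pos_of_orthogonal_timelike (B := g.pullbackForm φ (0, q))
      (r := ((1 : ℝ), (0 : F))) (u := ((0 : ℝ), v))
      (fun a b ↦ g.symm _ _ _) hz (by simp [hform]) (by simp [hform]) (by simp [hv])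
    simpa [hform] using h
  have hH : IsMetricOn H univ :=
    { isOpen := isOpen_univ
      contDiffOn := hHs.contDiffOn
      symm q _ u v := by
        have h : g.pullbackForm φ (0, q) (0, u) (0, v) = g.pullbackForm φ (0, q) (0, v) (0, u) :=
          g.symm _ _ _
        simpa [hform] using h
      nondegenerate q _ v hv := by
        by_contra h
        exact (hpos q v h).ne' (hv v) }
  obtain ⟨α, β, hα, -, hricci⟩ := hfluid.ricci_eq
  have hein := hH.isEinstein_of_isParametrization hdim hφ h0 hpos hgH hα fun q v w ↦ by
    have h1 (u : F) : g.form (φ (0, q)) (mfderiv 𝓘(ℝ, ℝ × F) 𝓘(ℝ, E) φ (0, q) ((0, u) : ℝ × F))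
        (ρ (φ (0, q))) = 0 := by
      rw [← hφρ _ (h0 q)]
      refine (hform q (0, u) (1, 0)).trans ?_
      simp
    have h2 : g.form (φ (0, q)) (mfderiv 𝓘(ℝ, ℝ × F) 𝓘(ℝ, E) φ (0, q) ((0, v) : ℝ × F))
        (mfderiv 𝓘(ℝ, ℝ × F) 𝓘(ℝ, E) φ (0, q) ((0, w) : ℝ × F)) = H q v w := by
      refine (hform q (0, v) (0, w)).trans ?_
      simp
    rw [hricci, h1, h1, h2]
    ring
  refine ⟨F, inferInstance, inferInstance, inferInstance, inferInstance, inferInstance,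
    inferInstance, hH.toPseudoRiemannianMetric, ball 0 ε, fun _ ↦ 1, φ, fun q v hv ↦ hpos q v hv,
    hein, isOpen_ball, (convex_ball 0 ε).ordConnected, nonempty_ball.2 hε, contDiffOn_const,
    fun _ _ ↦ one_pos, hsource, rfl, contMDiffOn_prod_self_iff.2 hφ.contMDiffOn,
    contMDiffOn_to_prod_self_iff.2 hφ.contMDiffOn_symm, fun t ht q a b u w ↦ ?_⟩
  have h := hgH (t, q) (by simpa [hsource] using ht) (a, u) (b, w)
  rw [one_pow, one_mul]
  exact (congr(g.form (φ (t, q)) $(mfderiv_prod_self_apply φ (t, q) (a, u))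
    $(mfderiv_prod_self_apply φ (t, q) (b, w)))).trans h

theorem theorem2p2 {M : Type*} [TopologicalSpace M] [ChartedSpace (EuclideanSpace ℝ (Fin 4)) M]
    [IsManifold 𝓘(ℝ, EuclideanSpace ℝ (Fin 4)) ∞ M] [T2Space M] [SecondCountableTopology M]
    (g : PseudoRiemannianMetric (EuclideanSpace ℝ (Fin 4)) M)
    (ρ : Π x : M, TangentSpace 𝓘(ℝ, EuclideanSpace ℝ (Fin 4)) x)
    (hfluid : g.IsPerfectFluid ρ) (hρ : g.IsConcircular ρ) (x : M) :
    ∃ U : Set M, IsOpen U ∧ x ∈ U ∧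
      g.IsGRWWithEinsteinFibreOn (EuclideanSpace ℝ (Fin 3)) U := by
  set E := EuclideanSpace ℝ (Fin 4)
  set F := EuclideanSpace ℝ (Fin 3)
  let φ₀ : OpenPartialHomeomorph E M := (chartAt E x).symm
  have hφ₀ : IsParametrization (E := E) φ₀ := ⟨contMDiffOn_chart_symm, contMDiffOn_chart⟩
  have hG := hφ₀.isMetricOn_pullbackForm g
  obtain ⟨Γ, hΓ⟩ := hG.exists_isChristoffel
  -- In the chart at `x`, the velocity field is a parallel unit timelike field.
  have hr : ContDiffOn ℝ ∞ (pullbackField φ₀ ρ) φ₀.source := fun p hp ↦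
    (hφ₀.contDiffAt_pullbackField hp (hfluid.smooth _)).contDiffWithinAt
  have hpar : ∀ p ∈ φ₀.source, ∀ u,
      fderiv ℝ (pullbackField φ₀ ρ) p u + Γ p u (pullbackField φ₀ ρ p) = 0 := by
    intro p hp u
    have h := hφ₀.leviCivita_apply hΓ hp ((hfluid.smooth _).mdifferentiableAt (by simp)) u
    rw [hρ.leviCivita_eq_zero hfluid.smooth hfluid.unit] at h
    exact hφ₀.mDifferentiable.mfderiv_injective hp (h.symm.trans (map_zero _).symm)
  have hunit : ∀ p ∈ φ₀.source,
      g.pullbackForm φ₀ p (pullbackField φ₀ ρ p) (pullbackField φ₀ ρ p) = -1 := fun p hp ↦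
    (hφ₀.pullbackForm_pullbackField g hp ρ ρ).trans (hfluid.unit _)
  obtain ⟨ε, hε, ψ, hψsource, hψx, hψtarget, hψ, hψsymm, hψρ, hψA⟩ :=
    exists_splitting_coordinates (F := F) (by simp [E, F]) hG hΓ hr hpar hunit
      (p₀ := chartAt E x x) (mem_chart_target E x)
  have hmaps : MapsTo ψ ψ.source φ₀.source := fun p hp ↦ hψtarget (ψ.map_source hp)
  have hsource : (ψ.trans φ₀).source = ball 0 ε ×ˢ univ := by
    rw [OpenPartialHomeomorph.trans_source, inter_eq_left.2 hmaps.subset_preimage, hψsource]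
  have hsource' : (ψ.trans φ₀).source = ψ.source := hsource.trans hψsource.symm
  have hφ : IsParametrization (E := E) (ψ.trans φ₀) := by
    refine ⟨?_, ?_⟩
    · rw [hsource']
      exact hφ₀.contMDiffOn.comp hψ.contMDiffOn hmaps
    · refine hψsymm.contMDiffOn.comp (hφ₀.contMDiffOn_symm.mono ?_) ?_
      · exact fun y hy ↦ hy.1
      · exact fun y hy ↦ hy.2
  have hD (p : ℝ × F) (hp : p ∈ ψ.source) (v : ℝ × F) :
      mfderiv 𝓘(ℝ, ℝ × F) 𝓘(ℝ, E) (ψ.trans φ₀) p v =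
        mfderiv 𝓘(ℝ, E) 𝓘(ℝ, E) φ₀ (ψ p) (fderiv ℝ ψ p v : E) := by
    have hψd : DifferentiableAt ℝ ψ p :=
      (hψ.contDiffAt (ψ.open_source.mem_nhds hp)).differentiableAt (by simp)
    have h := mfderiv_comp p (hφ₀.mdifferentiableAt (hmaps hp)) hψd.mdifferentiableAt
    refine (congr($h v)).trans ?_
    rw [mfderiv_eq_fderiv]
    rfl
  have hform (p : ℝ × F) (hp : p ∈ ψ.source) (v w : ℝ × F) :
      g.pullbackForm (ψ.trans φ₀) p v w =
        g.pullbackForm φ₀ (ψ p) (fderiv ℝ ψ p v) (fderiv ℝ ψ p w) :=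
    congr(g.form (φ₀ (ψ p)) $(hD p hp v) $(hD p hp w))
  have h0 (q : F) : ((0 : ℝ), q) ∈ ψ.source := by simp [hψsource, hε]
  -- The metric of the fibre is the metric induced on the hypersurface `t = 0`.
  let H (q : F) : F →L[ℝ] F →L[ℝ] ℝ :=
    let D := (fderiv ℝ ψ (0, q)).comp (ContinuousLinearMap.inr ℝ ℝ F)
    (g.pullbackForm φ₀ (ψ (0, q))).bilinearComp D D
  have hHs : ContDiff ℝ ∞ H := by
    have hi : ContDiff ℝ ∞ fun q : F ↦ ((0 : ℝ), q) := contDiff_const.prodMk contDiff_id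
    have h1 : ContDiff ℝ ∞ fun q : F ↦ g.pullbackForm φ₀ (ψ (0, q)) :=
      contDiffOn_univ.1 ((hG.contDiffOn.comp hψ hmaps).comp hi.contDiffOn fun q _ ↦ h0 q)
    have h2 : ContDiff ℝ ∞ fun q : F ↦ fderiv ℝ ψ (0, q) :=
      contDiffOn_univ.1 ((hψ.fderiv_of_isOpen ψ.open_source (m := ∞) (by simp)).comp
        hi.contDiffOn fun q _ ↦ h0 q)
    refine contDiff_clm_apply_iff.2 fun u ↦ contDiff_clm_apply_iff.2 fun v ↦ ?_
    exact (h1.clm_apply (h2.clm_apply contDiff_const)).clm_apply (h2.clm_apply contDiff_const)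
  refine ⟨(ψ.trans φ₀).target, (ψ.trans φ₀).open_target, ?_,
    hφ.isGRWWithEinsteinFibreOn (by simp [F]) hfluid hε hsource (fun p hp ↦ ?_) hHs
      fun p hp v w ↦ ?_⟩
  · exact ⟨mem_chart_source E x, hψx⟩
  · rw [hsource'] at hp
    refine (hD p hp (1, 0)).trans ?_
    rw [hψρ p hp]
    exact hφ₀.mfderiv_pullbackField (hmaps hp) ρ
  · rw [hsource'] at hp
    have hp1 : p.1 ∈ ball (0 : ℝ) ε := by rw [hψsource] at hp; exact hp.1
    rw [hform p hp]
    rw [hψsource] at hψ hmaps hψρ hψA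
    exact metric_comp_of_parallel hG hΓ hr hpar hunit hε hψ hmaps hψρ hψA hp1 p.2 v w

end Main
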